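/- A planar periodic framework $(G,\Gamma,p,\pi)$ consists of a connected simple graph $G=(V,E)$, a free abelian group $\Gamma$ of rank two acting on $G$ by automorphisms without fixed vertices or fixed edges and with finitely many vertex and edge orbits, an injective homomorphism $\pi:\Gamma\to\mathbb{R}^2$ whose image is a lattice of rank two, and a placement $p:V\to\mathbb{R}^2$ with $p(\gamma v)=p(v)+\pi(\gamma)$ for all $\gamma\in\Gamma$, $v\in V$, and $p(u)\ne p(v)$ for every edge $\{u,v\}$. An infinitesimal periodic motion is a pair $(\dot p,\dot\pi)$ of a map $\dot p:V\to\mathbb{R}^2$ and a homomorphism $\dot\pi:\Gamma\to\mathbb{R}^2$ with $\dot p(\gamma v)=\dot p(v)+\dot\pi(\gamma)$ and $\langle p(v)-p(u),\dot p(v)-\dot p(u)\rangle=0$ for every edge $\{u,v\}$. It is trivial if it is induced by an infinitesimal isometry: $\dot p(v)=A\,p(v)+t$ and $\dot\pi(\gamma)=A\,\pi(\gamma)$ with $A$ skew-symmetric and $t\in\mathbb{R}^2$. The framework is infinitesimally rigid if all its infinitesimal periodic motions are trivial, and ultrarigid if it is infinitesimally rigid and $(G,\tilde\Gamma,p,\pi|_{\tilde\Gamma})$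 is infinitesimally rigid for every subgroup $\tilde\Gamma\subset\Gamma$ of finite index. The framework is non-crossing if the closed segments of any two distinct edges are disjoint, except possibly for a common endpoint; its faces are then the connected components of the complement of the union of all edge segments. A pseudo-triangle is a simple closed polygon with exactly three internal angles smaller than $\pi$. A periodic pseudo-triangulation is a non-crossing planar periodic framework such that every face is the interior of a pseudo-triangle formed by vertices and edges of the framework and such that at every vertex the framework is pointed, i.e. the edge vectors at that vertex lie in an open half-plane bounded by a line through the origin. **Proposition.** Let $(G,\Gamma,p,\pi)$ be a periodic pseudo-triangulation and let $u,v\in V$ be two vertices whose distance varies under an infinitesimal periodic motion $(\dot p,\dot\pi)$ of it, that is, $\langle p(v)-p(u),\dot p(v)-\dot p(u)\rangle\neq 0$. Then the periodic framework obtained from it by inserting the $\Gamma$-orbit of the edge $\{u,v\}$ (possibly crossing other edges) is ultrarigid. -/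

import Mathlib

open Set Filter Topology

noncomputable section

/-- The Euclidean plane. -/
abbrev Plane : Type := EuclideanSpace ℝ (Fin 2)

/-- A `2`-periodic framework `(G, Γ, p, π)` in the plane. The periodicity group `Γ` (written
additively) is free abelian of rank two and acts on the connected simple graph `G` by automorphisms,
without fixed vertices or fixed edges and with finitely many vertex and edge orbits;
`π : Γ → ℝ²` identifies `Γ` with a rank two lattice of translations, and the placement `p` is
equivariant. Edges of `G` may cross. -/
structure PeriodicFramework (V Γ : Type*) [AddCommGroup Γ] [AddAction Γ V] where
  graph : SimpleGraph V
  connected : graph.Connected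
  adj_vadd : ∀ (γ : Γ) (a b : V), graph.Adj a b → graph.Adj (γ +ᵥ a) (γ +ᵥ b)
  free_group : Module.Free ℤ Γ
  rank_two : Module.finrank ℤ Γ = 2
  vertex_free : ∀ (γ : Γ) (a : V), γ +ᵥ a = a → γ = 0
  edge_free : ∀ (γ : Γ) (a b : V), graph.Adj a b → s(γ +ᵥ a, γ +ᵥ b) = s(a, b) → γ = 0
  vertex_orbits : ∃ S : Finset V, ∀ a, ∃ γ : Γ, ∃ s ∈ S, γ +ᵥ s = a
  edge_orbits : ∃ S : Finset (V × V), ∀ a b, graph.Adj a b →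
    ∃ γ : Γ, ∃ s ∈ S, γ +ᵥ s = (a, b)
  place : V → Plane
  place_ne : ∀ a b, graph.Adj a b → place a ≠ place b
  period : Γ →+ Plane
  period_injective : Function.Injective period
  period_span : Submodule.span ℝ (range period) = ⊤
  place_vadd : ∀ (γ : Γ) (a : V), place (γ +ᵥ a) = period γ + place a

namespace PeriodicFramework

/-- Finitely many orbits remain finitely many under a subgroup of finite index. -/
theorem finite_orbits_relax {X Γ : Type*} [AddCommGroup Γ] [AddAction Γ X] (H : AddSubgroup Γ)
    [H.FiniteIndex] (P : X → Prop)
    (h : ∃ S : Finset X, ∀ x, P x → ∃ γ : Γ, ∃ s ∈ S, γ +ᵥ s = x) :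
    ∃ S : Finset X, ∀ x, P x → ∃ γ : H, ∃ s ∈ S, γ +ᵥ s = x := by
  classical
  obtain ⟨S, hS⟩ := h
  have : Finite (Γ ⧸ H) := AddSubgroup.finite_quotient_of_finiteIndex
  have : Fintype (Γ ⧸ H) := Fintype.ofFinite _
  refine ⟨(Finset.univ ×ˢ S).image (fun q : (Γ ⧸ H) × X => ((Quotient.out q.1 : Γ) +ᵥ q.2 : X)), ?_⟩
  intro x hx
  obtain ⟨γ, s, hs, rfl⟩ := hS x hx
  have hmem : γ - (Quotient.out (γ : Γ ⧸ H) : Γ) ∈ H := by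
    have : ((Quotient.out (γ : Γ ⧸ H) : Γ) : Γ ⧸ H) = (γ : Γ ⧸ H) := Quotient.out_eq _
    rw [QuotientAddGroup.eq] at this
    have e : γ - (Quotient.out (γ : Γ ⧸ H) : Γ) = -(Quotient.out (γ : Γ ⧸ H) : Γ) + γ := by abel
    rw [e]; exact this
  refine ⟨⟨_, hmem⟩, ((Quotient.out (γ : Γ ⧸ H) : Γ) +ᵥ s : X), ?_, ?_⟩
  · exact Finset.mem_image.2 ⟨((γ : Γ ⧸ H), s), by simp [hs], rfl⟩
  · change (γ - (Quotient.out (γ : Γ ⧸ H) : Γ)) +ᵥ ((Quotient.out (γ : Γ ⧸ H) : Γ) +ᵥ s) = γ +ᵥ s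
    rw [vadd_vadd, sub_add_cancel]

variable {V Γ : Type*} [AddCommGroup Γ] [AddAction Γ V]

/-- Relaxation of periodicity: the same graph and placement, with the periodicity group restricted
to a subgroup of finite index. -/
def relax (F : PeriodicFramework V Γ) (H : AddSubgroup Γ) [H.FiniteIndex] :
    PeriodicFramework V H where
  graph := F.graph
  connected := F.connected
  adj_vadd γ a b h := F.adj_vadd (γ : Γ) a b h
  free_group := by
    have := F.free_group
    have : Module.Finite ℤ Γ := Module.finite_of_finrank_pos (by rw [F.rank_two]; norm_num)
    exact inferInstanceAs (Module.Free ℤ (AddSubgroup.toIntSubmodule H))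
  rank_two := by
    have := F.free_group
    have : Module.Finite ℤ Γ := Module.finite_of_finrank_pos (by rw [F.rank_two]; norm_num)
    rw [AddSubgroup.finrank_eq_of_finiteIndex H, F.rank_two]
  vertex_free γ a h := Subtype.ext (F.vertex_free (γ : Γ) a h)
  edge_free γ a b hab h := Subtype.ext (F.edge_free (γ : Γ) a b hab h)
  vertex_orbits := by
    obtain ⟨S, hS⟩ := finite_orbits_relax H (fun _ : V => True)
      (by obtain ⟨S, hS⟩ := F.vertex_orbits; exact ⟨S, fun x _ => hS x⟩)
    exact ⟨S, fun x => hS x trivial⟩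
  edge_orbits := by
    obtain ⟨S, hS⟩ := finite_orbits_relax H (fun e : V × V => F.graph.Adj e.1 e.2)
      (by obtain ⟨S, hS⟩ := F.edge_orbits; exact ⟨S, fun x hx => hS x.1 x.2 hx⟩)
    exact ⟨S, fun a b hab => hS (a, b) hab⟩
  place := F.place
  place_ne := F.place_ne
  period := F.period.comp H.subtype
  period_injective := F.period_injective.comp Subtype.val_injective
  period_span := by
    rw [eq_top_iff, ← F.period_span, Submodule.span_le]
    rintro _ ⟨γ, rfl⟩
    have hn : (H.index : ℝ) ≠ 0 := by exact_mod_cast AddSubgroup.FiniteIndex.index_ne_zero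
    have e : F.period γ = (H.index : ℝ)⁻¹ • F.period (H.index • γ) := by
      rw [map_nsmul, ← Nat.cast_smul_eq_nsmul ℝ, smul_smul, inv_mul_cancel₀ hn, one_smul]
    rw [e]
    exact Submodule.smul_mem _ _
      (Submodule.subset_span ⟨⟨H.index • γ, H.nsmul_index_mem γ⟩, rfl⟩)
  place_vadd γ a := F.place_vadd (γ : Γ) a

/-- Insertion of the `Γ`-orbit of the edge `{u, v}`, for two vertices with distinct positions. -/
def insertEdgeOrbit (F : PeriodicFramework V Γ) (u v : V) (huv : F.place u ≠ F.place v) :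
    PeriodicFramework V Γ where
  graph := F.graph ⊔ SimpleGraph.fromRel (fun a b => ∃ γ : Γ, a = γ +ᵥ u ∧ b = γ +ᵥ v)
  connected := F.connected.mono le_sup_left
  adj_vadd := by
    intro γ a b h
    rw [SimpleGraph.sup_adj, SimpleGraph.fromRel_adj] at h ⊢
    rcases h with h | ⟨hne, h⟩
    · exact Or.inl (F.adj_vadd γ a b h)
    · refine Or.inr ⟨fun e => hne (vadd_left_cancel γ e), ?_⟩
      rcases h with ⟨δ, rfl, rfl⟩ | ⟨δ, rfl, rfl⟩
      · exact Or.inl ⟨γ + δ, (vadd_vadd _ _ _), (vadd_vadd _ _ _)⟩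
      · exact Or.inr ⟨γ + δ, (vadd_vadd _ _ _), (vadd_vadd _ _ _)⟩
  free_group := F.free_group
  rank_two := F.rank_two
  vertex_free := F.vertex_free
  edge_free := by
    intro γ a b _ h
    have := F.free_group
    rcases Sym2.eq_iff.1 h with ⟨h1, _⟩ | ⟨h1, h2⟩
    · exact F.vertex_free γ a h1
    · have h3 : γ + γ = 0 := F.vertex_free _ a (by rw [← vadd_vadd, h1, h2])
      have h4 : (2 : ℤ) • γ = 0 := by rw [two_smul]; exact h3
      rcases smul_eq_zero.1 h4 with h5 | h5
      · norm_num at h5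
      · exact h5
  vertex_orbits := F.vertex_orbits
  edge_orbits := by
    classical
    obtain ⟨S, hS⟩ := F.edge_orbits
    refine ⟨insert (u, v) (insert (v, u) S), fun a b h => ?_⟩
    rw [SimpleGraph.sup_adj, SimpleGraph.fromRel_adj] at h
    rcases h with h | ⟨_, ⟨δ, rfl, rfl⟩ | ⟨δ, rfl, rfl⟩⟩
    · obtain ⟨γ, s, hs, e⟩ := hS a b h
      exact ⟨γ, s, by simp [hs], e⟩
    · exact ⟨δ, (u, v), by simp, rfl⟩
    · exact ⟨δ, (v, u), by simp, rfl⟩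
  place := F.place
  place_ne := by
    intro a b h
    rw [SimpleGraph.sup_adj, SimpleGraph.fromRel_adj] at h
    rcases h with h | ⟨_, ⟨δ, rfl, rfl⟩ | ⟨δ, rfl, rfl⟩⟩
    · exact F.place_ne a b h
    · rw [F.place_vadd, F.place_vadd]; exact fun e => huv (add_left_cancel e)
    · rw [F.place_vadd, F.place_vadd]; exact fun e => huv (add_left_cancel e).symm
  period := F.period
  period_injective := F.period_injective
  period_span := F.period_span
  place_vadd := F.place_vadd

/-! ### Infinitesimal periodic motions -/

/-- `(vel, per)` is an infinitesimal periodic motion: velocities of the vertices together with a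
variation of the periods (which are allowed to change), subject to the linearized periodicity
condition and to the linearized condition that every edge keeps its squared length. -/
def IsInfinitesimalMotion (F : PeriodicFramework V Γ) (vel : V → Plane) (per : Γ →+ Plane) : Prop :=
  (∀ (γ : Γ) (a : V), vel (γ +ᵥ a) = per γ + vel a) ∧
  ∀ a b, F.graph.Adj a b → inner ℝ (F.place b - F.place a) (vel b - vel a) = 0

/-- The motion `(vel, per)` is induced by an infinitesimal isometry `x ↦ A x + t` of the plane, with
`A` skew-symmetric. -/
def IsTrivialMotion (F : PeriodicFramework V Γ) (vel : V → Plane) (per : Γ →+ Plane) : Prop :=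
  ∃ (A : Plane →ₗ[ℝ] Plane) (t : Plane), (∀ x y, inner ℝ (A x) y = -inner ℝ x (A y)) ∧
    (∀ a, vel a = A (F.place a) + t) ∧ ∀ γ, per γ = A (F.period γ)

/-- Infinitesimal (periodic) rigidity: all infinitesimal periodic motions are trivial. -/
def InfinitesimallyRigid (F : PeriodicFramework V Γ) : Prop :=
  ∀ (vel : V → Plane) (per : Γ →+ Plane),
    F.IsInfinitesimalMotion vel per → F.IsTrivialMotion vel per

/-- Ultrarigidity: infinitesimal rigidity, also after every relaxation of periodicity to a subgroup
of finite index. -/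
def Ultrarigid (F : PeriodicFramework V Γ) : Prop :=
  F.InfinitesimallyRigid ∧
    ∀ (H : AddSubgroup Γ) [H.FiniteIndex], (F.relax H).InfinitesimallyRigid

/-- Half the infinitesimal variation, under the vertex velocities `vel`, of the squared distance
between the vertices `u` and `v`. -/
def distanceVariation (F : PeriodicFramework V Γ) (vel : V → Plane) (u v : V) : ℝ :=
  inner ℝ (F.place v - F.place u) (vel v - vel u)

theorem place_ne_of_distanceVariation_ne_zero (F : PeriodicFramework V Γ) {vel : V → Plane}
    {u v : V} (h : F.distanceVariation vel u v ≠ 0) : F.place u ≠ F.place v := by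
  intro e
  apply h
  simp [distanceVariation, e]

/-! ### Pseudo-triangulations -/

/-- Two distinct edges meet at most in the position of a common endpoint. -/
def NonCrossing (F : PeriodicFramework V Γ) : Prop :=
  ∀ a b c d, F.graph.Adj a b → F.graph.Adj c d → s(a, b) ≠ s(c, d) →
    segment ℝ (F.place a) (F.place b) ∩ segment ℝ (F.place c) (F.place d) ⊆
      F.place '' ({a, b} ∩ {c, d})

/-- The union of all edge segments. (Every vertex is an endpoint of an edge.) -/
def drawing (F : PeriodicFramework V Γ) : Set Plane :=
  {x | ∃ a b, F.graph.Adj a b ∧ x ∈ segment ℝ (F.place a) (F.place b)}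

/-- The faces are the connected components of the complement of the drawing. -/
def IsFace (F : PeriodicFramework V Γ) (U : Set Plane) : Prop :=
  ∃ x ∈ F.drawingᶜ, U = connectedComponentIn F.drawingᶜ x

end PeriodicFramework

/-- A set of vectors is pointed if no nonempty finite part of it has a linear combination with
strictly positive coefficients equal to zero. (For a finite set: it lies in an open half-plane
bounded by a line through the origin.) -/
def IsPointedSet (S : Set Plane) : Prop :=
  ∀ T : Finset Plane, T.Nonempty → (T : Set Plane) ⊆ S →
    ∀ c : Plane → ℝ, (∀ x ∈ T, 0 < c x) → ∑ x ∈ T, c x • x ≠ 0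

/-- `q 0, q 1, …, q (k - 1)` are the consecutive vertices of a simple closed polygon: they are
distinct, two consecutive sides meet only in their common vertex, and other sides are disjoint. -/
def IsSimplePolygon {k : ℕ} (q : ZMod k → Plane) : Prop :=
  3 ≤ k ∧ Function.Injective q ∧
  (∀ i, segment ℝ (q i) (q (i + 1)) ∩ segment ℝ (q (i + 1)) (q (i + 2)) = {q (i + 1)}) ∧
  ∀ i j, i ≠ j → j ≠ i + 1 → i ≠ j + 1 →
    Disjoint (segment ℝ (q i) (q (i + 1))) (segment ℝ (q j) (q (j + 1)))

/-- `U` is the (open) polygonal region enclosed by the closed polygon `q`. For a simple polygon these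
conditions determine `U` as the bounded component of the complement of the polygon. -/
def IsPolygonInterior {k : ℕ} (q : ZMod k → Plane) (U : Set Plane) : Prop :=
  IsOpen U ∧ IsConnected U ∧ Bornology.IsBounded U ∧
    frontier U = ⋃ i, segment ℝ (q i) (q (i + 1))

open Classical in
/-- The internal angle, in `(0, 2π)`, at the vertex `x` of a simple polygon with interior `U`, where
`a` and `b` are the neighbours of `x` on the polygon. The unoriented angle `∠ a x b` in `(0, π]` is
the internal angle when `U` contains, near `x`, the convex sector between the two sides (tested on
the ray in the direction `(a - x) + (b - x)`); otherwise the internal angle is `2π - ∠ a x b`. -/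
def internalAngle (U : Set Plane) (a x b : Plane) : ℝ :=
  if ∀ᶠ t : ℝ in 𝓝[>] 0, x + t • ((a - x) + (b - x)) ∈ U then EuclideanGeometry.angle a x b
  else 2 * Real.pi - EuclideanGeometry.angle a x b

/-- A pseudo-triangle: a simple closed polygon `q`, with interior `U`, with exactly three internal
angles smaller than `π`. -/
def IsPseudoTriangle {k : ℕ} (q : ZMod k → Plane) (U : Set Plane) : Prop :=
  IsSimplePolygon q ∧ IsPolygonInterior q U ∧
    {i : ZMod k | internalAngle U (q (i - 1)) (q i) (q (i + 1)) < Real.pi}.ncard = 3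

namespace PeriodicFramework

variable {V Γ : Type*} [AddCommGroup Γ] [AddAction Γ V]

/-- A periodic (pointed) pseudo-triangulation: a non-crossing periodic framework, pointed at every
vertex, such that every face is the interior of a pseudo-triangle whose vertices and sides are
vertices and edges of the framework. -/
def IsPseudoTriangulation (F : PeriodicFramework V Γ) : Prop :=
  F.NonCrossing ∧
  (∀ a, IsPointedSet {x | ∃ b, F.graph.Adj a b ∧ x = F.place b - F.place a}) ∧
  ∀ U, F.IsFace U → ∃ (k : ℕ) (w : ZMod k → V),
    (∀ i, F.graph.Adj (w i) (w (i + 1))) ∧ IsPseudoTriangle (fun i => F.place (w i)) U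

end PeriodicFramework

end

/-!
The heart of the matter is that any two infinitesimal motions of a periodic pseudo-triangulation
are linearly dependent modulo trivial motions
(`PeriodicFramework.IsPseudoTriangulation.exists_combination_trivial`). Relaxing the periodicity
gives again a pseudo-triangulation, of which the given motion is still a motion; a motion of the
framework with the inserted edges is then the sum of a multiple of the given motion and a trivial
motion, and the multiple vanishes because the distance between `u` and `v` is preserved.

To bound the space of motions, rotate all velocities by a right angle. A motion becomes a parallel
redrawing: an equivariant map `r` of the vertices with `r b - r a` parallel to `p b - p a` along
every edge. The periods of `r` are `L ∘ π` for a linear map `L` of the plane. The argument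
compares the area of the fundamental domain with the areas of the faces.

* The signed area of a pseudo-triangle is a positive definite quadratic form on its parallel
  redrawings (`Plane.area_form_of_three_left_turns`). By Hopf's Umlaufsatz
  (`Plane.sum_turn_eq_two_pi`) the total turning is `2π`; as there are exactly three left turns,
  the line that carries the edge rotates clockwise throughout, by `π` in total
  (`Plane.exists_signs_sorted`). For edge vectors sorted in this way the area is a sum of squares
  (`Plane.area_form_of_sorted`).
* Every directed edge is a side of the counterclockwise boundary polygon of exactly one face
  (`PeriodicFramework.IsPseudoTriangulation.exists_polygon`), so the sum of the areas of the
  redrawn faces over the orbits equals `det L` times the same sum for the original placement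
  (`PeriodicFramework.sum_area_eq_det_mul`).

Hence `det L ≤ 0` forces a redrawing to collapse to a point. The determinant is negative definite
on the plane of symmetric traceless matrices, and every three-dimensional space of matrices meets
this plane nontrivially. Applied to the lattice matrices of two motions and of an infinitesimal
rotation (whose redrawing is the placement itself, with `L` the identity), this gives the linear
dependence.
-/

namespace Plane

/-! ### Cross product and oriented angles in the plane -/

/-- The cross product (signed area of the parallelogram) of two vectors of the plane. -/
def cross (x y : Plane) : ℝ := x 0 * y 1 - x 1 * y 0

/-- The counterclockwise rotation by a right angle. -/
noncomputable def J : Plane →ₗ[ℝ] Plane where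
  toFun x := !₂[-x 1, x 0]
  map_add' x y := by ext i; fin_cases i <;> simp; ring
  map_smul' c x := by ext i; fin_cases i <;> simp

@[simp] theorem J_apply_zero (x : Plane) : J x 0 = -x 1 := by simp [J]

@[simp] theorem J_apply_one (x : Plane) : J x 1 = x 0 := by simp [J]

theorem inner_eq (x y : Plane) : inner ℝ x y = x 0 * y 0 + x 1 * y 1 := by
  simp [PiLp.inner_apply, Fin.sum_univ_two, mul_comm]

theorem ext_coords {x y : Plane} (h0 : x 0 = y 0) (h1 : x 1 = y 1) : x = y := by
  ext i; fin_cases i <;> assumption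

theorem J_J (x : Plane) : J (J x) = -x := ext_coords (by simp) (by simp)

theorem cross_add_left (x y z : Plane) : cross (x + y) z = cross x z + cross y z := by
  simp [cross]; ring

theorem cross_add_right (x y z : Plane) : cross x (y + z) = cross x y + cross x z := by
  simp [cross]; ring

theorem cross_sub_left (x y z : Plane) : cross (x - y) z = cross x z - cross y z := by
  simp [cross]; ring

theorem cross_sub_right (x y z : Plane) : cross x (y - z) = cross x y - cross x z := by
  simp [cross]; ring

theorem cross_smul_left (c : ℝ) (x y : Plane) : cross (c • x) y = c * cross x y := by
  simp [cross]; ring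

theorem cross_smul_right (c : ℝ) (x y : Plane) : cross x (c • y) = c * cross x y := by
  simp [cross]; ring

theorem cross_neg_left (x y : Plane) : cross (-x) y = -cross x y := by
  simp [cross]; ring

theorem cross_neg_right (x y : Plane) : cross x (-y) = -cross x y := by
  simp [cross]; ring

@[simp] theorem cross_self (x : Plane) : cross x x = 0 := by simp [cross, mul_comm]

@[simp] theorem cross_zero_left (x : Plane) : cross 0 x = 0 := by simp [cross]

@[simp] theorem cross_zero_right (x : Plane) : cross x 0 = 0 := by simp [cross]

theorem cross_swap (x y : Plane) : cross x y = -cross y x := by simp [cross]; ring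

theorem cross_J (x : Plane) : cross x (J x) = inner ℝ x x := by
  rw [inner_eq]; simp [cross]

theorem cross_J_right (x y : Plane) : cross x (J y) = inner ℝ x y := by
  simp [cross, inner_eq]

theorem inner_J (x y : Plane) : inner ℝ (J x) y = -inner ℝ x (J y) := by
  simp [inner_eq]

/-- The Plücker relation. -/
theorem cross_plucker (r a b c : Plane) :
    cross r a * cross b c + cross r b * cross c a + cross r c * cross a b = 0 := by
  simp [cross]; ring

theorem exists_smul_of_cross_eq_zero {x y : Plane} (hx : x ≠ 0) (h : cross x y = 0) :
    ∃ c : ℝ, y = c • x := by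
  have hpos : x 0 * x 0 + x 1 * x 1 ≠ 0 := by
    rw [← inner_eq]; exact inner_self_ne_zero.2 hx
  simp only [cross] at h
  refine ⟨(x 0 * y 0 + x 1 * y 1) / (x 0 * x 0 + x 1 * x 1), ext_coords ?_ ?_⟩
  · simp only [PiLp.smul_apply, smul_eq_mul]
    rw [div_mul_eq_mul_div, eq_div_iff hpos]
    linear_combination -x 1 * h
  · simp only [PiLp.smul_apply, smul_eq_mul]
    rw [div_mul_eq_mul_div, eq_div_iff hpos]
    linear_combination x 0 * h

/-- The quotient `y / x` of two vectors viewed as complex numbers, multiplied by `‖x‖ ^ 2`. -/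
noncomputable def conjMul (x y : Plane) : ℂ := ⟨inner ℝ x y, cross x y⟩

theorem conjMul_mul_conjMul (x y z : Plane) :
    conjMul x y * conjMul y z = ((inner ℝ y y : ℝ) : ℂ) * conjMul x z := by
  rw [inner_eq]
  apply Complex.ext <;> simp [conjMul, inner_eq, cross] <;> ring

/-- The oriented angle in `(-π, π]` from `x` to `y`. -/
noncomputable def turn (x y : Plane) : ℝ := (conjMul x y).arg

theorem conjMul_swap (x y : Plane) : conjMul y x = (starRingEnd ℂ) (conjMul x y) := by
  apply Complex.ext <;> simp [conjMul, inner_eq, cross] <;> ring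

/-- On an open half-plane the angle is a coboundary: it is the difference of the angles
measured from the inner normal `n`. -/
theorem turn_eq_sub {n x y : Plane} (hx : 0 < inner ℝ n x) (hy : 0 < inner ℝ n y) :
    turn x y = turn n y - turn n x := by
  have hn : n ≠ 0 := by rintro rfl; simp at hx
  have ax : |(conjMul n x).arg| < Real.pi / 2 := Complex.abs_arg_lt_pi_div_two_iff.2 (Or.inl hx)
  have ay : |(conjMul n y).arg| < Real.pi / 2 := Complex.abs_arg_lt_pi_div_two_iff.2 (Or.inl hy)
  rw [abs_lt] at ax ay
  have key := conjMul_mul_conjMul x n y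
  have hxn : (conjMul x n).arg = -(conjMul n x).arg := by
    rw [conjMul_swap, Complex.arg_conj, if_neg]; intro h; linarith [Real.pi_pos]
  have h1 : (conjMul x n * conjMul n y).arg = (conjMul x n).arg + (conjMul n y).arg := by
    apply Complex.arg_mul
    · intro h; have := congrArg Complex.re h
      simp only [conjMul, Complex.zero_re] at this
      rw [real_inner_comm] at this; linarith
    · intro h; have := congrArg Complex.re h
      simp only [conjMul, Complex.zero_re] at this; linarith
    · rw [hxn]; constructor <;> linarith
  rw [key, Complex.arg_real_mul _ (real_inner_self_pos.2 hn), hxn] at h1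
  unfold turn; linarith

theorem turn_self {x : Plane} : turn x x = 0 := by
  have : conjMul x x = ((inner ℝ x x : ℝ) : ℂ) := by
    apply Complex.ext
    · rw [Complex.ofReal_re, conjMul]
    · rw [Complex.ofReal_im, conjMul, cross_self]
  rw [turn, this, Complex.arg_ofReal_of_nonneg real_inner_self_nonneg]

theorem turn_neg_neg (x y : Plane) : turn (-x) (-y) = turn x y := by
  have : conjMul (-x) (-y) = conjMul x y := by
    apply Complex.ext <;> simp [conjMul, cross]
  rw [turn, this, turn]

theorem turn_neg_iff {x y : Plane} : turn x y < 0 ↔ cross x y < 0 := Complex.arg_neg_iff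

theorem turn_lt_pi {x y : Plane} (h : cross x y ≠ 0) : turn x y < Real.pi :=
  lt_of_le_of_ne (Complex.arg_le_pi _) fun e => h (Complex.arg_eq_pi_iff.1 e).2

/-- The sum of the angles on the two sides of a ray is a straight angle. -/
theorem turn_add_turn_neg {x y : Plane} (h : 0 < cross x y) : turn x y + turn y (-x) = Real.pi := by
  have e : conjMul y (-x) = -(starRingEnd ℂ) (conjMul x y) := by
    apply Complex.ext <;> simp [conjMul, inner_eq, cross] <;> ring
  have h1 : ((starRingEnd ℂ) (conjMul x y)).im < 0 := by simpa [conjMul] using h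
  rw [turn, turn, e, Complex.arg_neg_eq_arg_add_pi_of_im_neg h1, Complex.arg_conj, if_neg]
  · ring
  · intro h2; exact h.ne' (Complex.arg_eq_pi_iff.1 h2).2

theorem turn_add {n x y z : Plane} (hx : 0 < inner ℝ n x) (hy : 0 < inner ℝ n y)
    (hz : 0 < inner ℝ n z) : turn x y + turn y z = turn x z := by
  rw [turn_eq_sub hx hy, turn_eq_sub hy hz, turn_eq_sub hx hz]; ring

theorem exists_inner_pos_of_cross_ne_zero {x y : Plane} (h : cross x y ≠ 0) :
    ∃ n : Plane, 0 < inner ℝ n x ∧ 0 < inner ℝ n y := by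
  refine ⟨!₂[(y 1 - x 1) / cross x y, (x 0 - y 0) / cross x y], ?_, ?_⟩
  · have : inner ℝ (!₂[(y 1 - x 1) / cross x y, (x 0 - y 0) / cross x y] : Plane) x = 1 := by
      rw [inner_eq]; simp; field_simp; simp [cross]; ring
    rw [this]; exact one_pos
  · have : inner ℝ (!₂[(y 1 - x 1) / cross x y, (x 0 - y 0) / cross x y] : Plane) y = 1 := by
      rw [inner_eq]; simp; field_simp; simp [cross]; ring
    rw [this]; exact one_pos

theorem turn_add_of_cross_ne_zero {x y : Plane} (h : cross x y ≠ 0) :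
    turn x (x + y) + turn (x + y) y = turn x y := by
  obtain ⟨n, hx, hy⟩ := exists_inner_pos_of_cross_ne_zero h
  exact turn_add hx (by rw [inner_add_right]; linarith) hy

theorem isCompact_segment (a b : Plane) : IsCompact (segment ℝ a b) := by
  rw [segment_eq_image_lineMap]
  exact isCompact_Icc.image (AffineMap.lineMap_continuous)

/-- The secants between two disjoint segments lie in an open half-plane. -/
theorem exists_inner_pos_of_disjoint_segment {a b c d : Plane}
    (h : Disjoint (segment ℝ a b) (segment ℝ c d)) :
    ∃ n : Plane, ∀ x ∈ segment ℝ a b, ∀ y ∈ segment ℝ c d, 0 < inner ℝ n (y - x) := by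
  obtain ⟨f, u, v, h1, h2, h3⟩ := geometric_hahn_banach_compact_closed (convex_segment a b)
    (isCompact_segment a b) (convex_segment c d) (isCompact_segment c d).isClosed h
  refine ⟨(InnerProductSpace.toDual ℝ Plane).symm f, fun x hx y hy => ?_⟩
  rw [InnerProductSpace.toDual_symm_apply, map_sub]
  linarith [h1 x hx, h3 y hy]

/-- The angle is additive around the parallelogram of secants between two disjoint segments. -/
theorem turn_secants {a b c d : Plane} (h : Disjoint (segment ℝ a b) (segment ℝ c d)) :
    turn (c - a) (d - a) + turn (d - a) (d - b) = turn (c - a) (c - b) + turn (c - b) (d - b) := by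
  obtain ⟨n, hn⟩ := exists_inner_pos_of_disjoint_segment h
  have ha := left_mem_segment ℝ a b
  have hb := right_mem_segment ℝ a b
  have hc := left_mem_segment ℝ c d
  have hd := right_mem_segment ℝ c d
  rw [turn_add (hn a ha c hc) (hn a ha d hd) (hn b hb d hd),
    turn_add (hn a ha c hc) (hn b hb c hc) (hn b hb d hd)]

/-! ### The total turning of a simple polygon -/

section Umlaufsatz

variable (q : ℕ → Plane)

/-- Homotopy step: the secants ending at the vertex `j` are pushed to those ending at the vertex
`j + 1`. -/
theorem turn_secant_column {k : ℕ}
    (hdis : ∀ i j, i + 1 < j → j < k → (i ≠ 0 ∨ j + 1 ≠ k) →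
      Disjoint (segment ℝ (q i) (q (i + 1))) (segment ℝ (q j) (q (j + 1))))
    (hc : ∀ i, i < k → cross (q (i + 1) - q i) (q (i + 2) - q (i + 1)) ≠ 0) (m : ℕ) :
    ∀ a, a + m + 2 ≤ k → (a ≠ 0 ∨ a + m + 2 ≠ k) →
      turn (q (a + m + 1) - q a) (q (a + m + 2) - q a) +
        ∑ i ∈ Finset.Ico a (a + m + 1), turn (q (a + m + 2) - q i) (q (a + m + 2) - q (i + 1)) =
      ∑ i ∈ Finset.Ico a (a + m), turn (q (a + m + 1) - q i) (q (a + m + 1) - q (i + 1)) +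
        turn (q (a + m + 1) - q (a + m)) (q (a + m + 2) - q (a + m + 1)) := by
  induction m with
  | zero =>
    intro a ha _
    have := turn_add_of_cross_ne_zero (hc a (by omega))
    simp only [add_zero, Finset.Ico_self, Finset.sum_empty, zero_add, Nat.Ico_succ_singleton,
      Finset.sum_singleton]
    rw [← this]
    congr 2 <;> abel
  | succ m ih =>
    intro a ha h0
    have h1 := ih (a + 1) (by omega) (Or.inl (by omega))
    have e : a + 1 + m = a + (m + 1) := by ring
    rw [e] at h1
    rw [Finset.sum_eq_sum_Ico_succ_bot (by omega),
      Finset.sum_eq_sum_Ico_succ_bot (show a < a + (m + 1) by omega)]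
    have h2 := turn_secants (hdis a (a + (m + 1) + 1) (by omega) (by omega) (by omega))
    rw [show a + (m + 1) + 1 + 1 = a + (m + 1) + 2 by ring] at h2
    linarith

/-- Hopf's Umlaufsatz for simple polygons: if the polygon turns left at a vertex `q 0` where it is
strictly supported by a line, then its total turning is `2π`. -/
theorem sum_turn_eq_two_pi {k : ℕ} (hk : 3 ≤ k) (hq0 : q k = q 0) (hq1 : q (k + 1) = q 1)
    (hdis : ∀ i j, i + 1 < j → j < k → (i ≠ 0 ∨ j + 1 ≠ k) →
      Disjoint (segment ℝ (q i) (q (i + 1))) (segment ℝ (q j) (q (j + 1))))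
    (hc : ∀ i, i < k → cross (q (i + 1) - q i) (q (i + 2) - q (i + 1)) ≠ 0)
    {n : Plane} (hn : ∀ j, 0 < j → j < k → 0 < inner ℝ n (q j - q 0))
    (hleft : 0 < cross (q 1 - q 0) (q (k - 1) - q 0)) :
    ∑ i ∈ Finset.range k, turn (q (i + 1) - q i) (q (i + 2) - q (i + 1)) = 2 * Real.pi := by
  -- The edge directions up to the vertex `j` turn as much as the secants along the path
  -- `(0, 1) → (0, j) → (j - 1, j)`.
  have hB : ∀ j, j + 1 < k → turn (q 1 - q 0) (q (j + 1) - q 0) +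
      ∑ i ∈ Finset.Ico 0 j, turn (q (j + 1) - q i) (q (j + 1) - q (i + 1)) =
      ∑ i ∈ Finset.range j, turn (q (i + 1) - q i) (q (i + 2) - q (i + 1)) := by
    intro j
    induction j with
    | zero => intro _; simp [turn_self]
    | succ j ih =>
      intro hj
      have h1 := ih (by omega)
      have h2 := turn_secant_column q hdis hc j 0 (by omega) (by omega)
      simp only [zero_add] at h2
      rw [Finset.sum_range_succ, ← h1]
      have h3 := turn_add (hn 1 (by omega) (by omega)) (hn (j + 1) (by omega) (by omega))
        (hn (j + 2) (by omega) (by omega))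
      rw [show j + 1 + 1 = j + 2 by ring]
      linarith
  obtain ⟨m, rfl⟩ : ∃ m, k = m + 3 := ⟨k - 3, by omega⟩
  have h1 := hB (m + 1) (by omega)
  rw [Finset.sum_eq_sum_Ico_succ_bot (by omega)] at h1
  have h2 := turn_secant_column q hdis hc m 1 (by omega) (Or.inl (by omega))
  simp only [zero_add, show 1 + m = m + 1 by ring, show m + 1 + 1 = m + 2 by ring,
    show m + 1 + 2 = m + 3 by ring, show m + 3 - 1 = m + 2 by omega] at h1 h2 hleft
  rw [hq0] at h2
  -- The secants ending at `q k = q 0` are opposite to those starting there.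
  have hD : ∀ j, j < m + 2 → ∑ i ∈ Finset.Ico 1 (j + 1), turn (q 0 - q i) (q 0 - q (i + 1)) =
      turn (q 1 - q 0) (q (j + 1) - q 0) := by
    intro j
    induction j with
    | zero => intro _; simp [turn_self]
    | succ j ih =>
      intro hj
      rw [Finset.sum_Ico_succ_top (by omega), ih (by omega), ← turn_neg_neg (q 0 - _), neg_sub,
        neg_sub]
      exact turn_add (hn 1 (by omega) (by omega)) (hn (j + 1) (by omega) (by omega))
        (hn (j + 2) (by omega) (by omega))
  rw [hD (m + 1) (by omega)] at h2
  simp only [show m + 1 + 1 = m + 2 by ring] at h2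
  rw [Finset.sum_range_succ, Finset.sum_range_succ]
  simp only [show m + 1 + 1 = m + 2 by ring, show m + 2 + 1 = m + 3 by ring,
    show m + 2 + 2 = m + 3 + 1 by ring]
  rw [hq0, hq1]
  have h3 := turn_add_turn_neg hleft
  have hne : cross (q (m + 2) - q 0) (-(q 1 - q 0)) ≠ 0 := by
    rw [cross_neg_right, ← cross_swap]; exact hleft.ne'
  have h4 := turn_add_of_cross_ne_zero hne
  have e1 : q (m + 2) - q 0 + -(q 1 - q 0) = q (m + 2) - q 1 := by abel
  rw [e1, neg_sub] at h4
  rw [neg_sub] at h3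
  have h5 : turn (q 0 - q (m + 2)) (q 1 - q 0) = turn (q (m + 2) - q 0) (q 0 - q 1) := by
    rw [← turn_neg_neg, neg_sub, neg_sub]
  linarith

end Umlaufsatz

/-! ### The area form of a pseudo-triangle -/

/-- Signed edge vectors `u j` sorted clockwise within a half-turn: the area of any closed polygon
with edges `s j • u j` is nonnegative. The proof is an Abel summation that exhibits the area as a
sum of squares; it is the discrete form of the identity
`∫ (h' ^ 2 - h ^ 2) = ∫ g ^ 2 * (h / g)' ^ 2` for a function `h` vanishing at the ends of an
interval of length less than `π` and a sine wave `g`. -/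
theorem area_form_of_sorted {k : ℕ} (hk : 3 ≤ k) (u R : ℕ → Plane) (s : ℕ → ℝ)
    (hu : ∀ i j, i < j → j < k → cross (u i) (u j) < 0)
    (hR0 : R 0 = 0) (hRk : R k = 0) (hR : ∀ j, j < k → R (j + 1) = R j + s j • u j) :
    0 ≤ ∑ j ∈ Finset.range k, cross (R j) (R (j + 1)) ∧
      (∑ j ∈ Finset.range k, cross (R j) (R (j + 1)) = 0 → ∀ j, j < k → s j = 0) := by
  set c : ℕ → ℝ := fun j => cross (u j) (u 0) with hc
  set y : ℕ → ℝ := fun j => cross (R j) (u 0) with hy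
  set t : ℕ → ℝ := fun j => cross (R j) (u j) / c j with ht
  set g : ℕ → ℝ := fun j => y (j + 1) ^ 2 * (-cross (u j) (u (j + 1)) / (c j * c (j + 1))) with hg
  have hcpos : ∀ j, 0 < j → j < k → 0 < c j := fun j h0 hj => by
    have := hu 0 j h0 hj
    rw [cross_swap] at this
    simp only [hc]; linarith
  have hgnn : ∀ j, 0 < j → j + 1 < k → 0 ≤ g j := fun j h0 hj => by
    have := hu j (j + 1) (by omega) hj
    have := hcpos j h0 (by omega)
    have := hcpos (j + 1) (by omega) hj
    have : 0 ≤ -cross (u j) (u (j + 1)) := by linarith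
    simp only [hg]; positivity
  have hR1 : R 1 = s 0 • u 0 := by rw [hR 0 (by omega), hR0, zero_add]
  have hy1 : y 1 = 0 := by simp [hy, hR1, cross_smul_left]
  have hyk : y k = 0 := by simp [hy, hRk]
  have hystep : ∀ j, j < k → y (j + 1) = y j + s j * c j := fun j hj => by
    simp [hy, hc, hR j hj, cross_add_left, cross_smul_left]
  have hterm : ∀ j, 0 < j → j < k → cross (R j) (R (j + 1)) = (y (j + 1) - y j) * t j := by
    intro j h0 hj
    have := (hcpos j h0 hj).ne'
    rw [hystep j hj, hR j hj, cross_add_right, cross_self, cross_smul_right]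
    simp only [ht]; field_simp; ring
  have htstep : ∀ j, 0 < j → j + 1 < k → y (j + 1) * (t j - t (j + 1)) = g j := by
    intro j h0 hj
    have h1 := (hcpos j h0 (by omega)).ne'
    have h2 := (hcpos (j + 1) (by omega) hj).ne'
    have h3 := cross_plucker (R (j + 1)) (u j) (u (j + 1)) (u 0)
    have h4 : cross (R (j + 1)) (u j) = cross (R j) (u j) := by
      rw [hR j (by omega), cross_add_left, cross_smul_left, cross_self]; ring
    rw [h4, cross_swap (u 0)] at h3
    simp only [ht, hg]
    rw [div_sub_div _ _ h1 h2, mul_div_assoc', mul_div_assoc']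
    congr 1
    simp only [hc, hy]
    linear_combination cross (R (j + 1)) (u 0) * h3
  have hpart : ∀ m, m + 1 < k → ∑ j ∈ Finset.range (m + 1), cross (R j) (R (j + 1)) =
      y (m + 1) * t (m + 1) + ∑ j ∈ Finset.range m, g (j + 1) := by
    intro m
    induction m with
    | zero => intro _; simp [hR0, hy1]
    | succ m ih =>
      intro hm
      rw [Finset.sum_range_succ, ih (by omega), hterm (m + 1) (by omega) (by omega),
        Finset.sum_range_succ _ m, ← htstep (m + 1) (by omega) hm]
      ring
  obtain ⟨m, rfl⟩ : ∃ m, k = m + 2 := ⟨k - 2, by omega⟩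
  have hsum : ∑ j ∈ Finset.range (m + 2), cross (R j) (R (j + 1)) =
      ∑ j ∈ Finset.range m, g (j + 1) := by
    rw [Finset.sum_range_succ, hpart m (by omega), hterm (m + 1) (by omega) (by omega), hyk]
    ring
  have hnn : ∀ j ∈ Finset.range m, 0 ≤ g (j + 1) := fun j hj => by
    rw [Finset.mem_range] at hj
    exact hgnn _ (by omega) (by omega)
  rw [hsum]
  refine ⟨Finset.sum_nonneg hnn, fun h0 => ?_⟩
  rw [Finset.sum_eq_zero_iff_of_nonneg hnn] at h0
  have hy0 : ∀ j, 0 < j → j ≤ m + 2 → y j = 0 := by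
    intro j hj hj'
    rcases Nat.lt_or_ge j 2 with h | h
    · rw [show j = 1 by omega, hy1]
    rcases Nat.lt_or_ge j (m + 2) with h' | h'
    · obtain ⟨i, rfl⟩ : ∃ i, j = i + 2 := ⟨j - 2, by omega⟩
      have h1 := h0 i (Finset.mem_range.2 (by omega))
      have h2 := hu (i + 1) (i + 2) (by omega) (by omega)
      have h3 := hcpos (i + 1) (by omega) (by omega)
      have h4 := hcpos (i + 2) (by omega) (by omega)
      have h5 : 0 < -cross (u (i + 1)) (u (i + 2)) / (c (i + 1) * c (i + 2)) :=
        div_pos (by linarith) (mul_pos h3 h4)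
      rcases mul_eq_zero.1 h1 with h6 | h6
      · exact pow_eq_zero_iff (two_ne_zero) |>.1 h6
      · exact absurd h6 h5.ne'
    · rw [show j = m + 2 by omega, hyk]
  have hs : ∀ j, 0 < j → j < m + 2 → s j = 0 := fun j hj hj' => by
    have h1 := hystep j hj'
    rw [hy0 j hj (by omega), hy0 (j + 1) (by omega) (by omega), zero_add] at h1
    exact (mul_eq_zero.1 h1.symm).resolve_right (hcpos j hj hj').ne'
  intro j hj
  rcases Nat.eq_zero_or_pos j with rfl | h
  · have hconst : ∀ i, i + 1 ≤ m + 2 → R (i + 1) = R 1 := by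
      intro i
      induction i with
      | zero => intro _; rfl
      | succ i ih =>
        intro hi
        rw [hR (i + 1) (by omega), hs (i + 1) (by omega) (by omega), ih (by omega)]; simp
    have h1 := hconst (m + 1) le_rfl
    rw [show m + 1 + 1 = m + 2 by ring, hRk, hR1] at h1
    refine (smul_eq_zero.1 h1.symm).resolve_right fun h2 => ?_
    have := hu 0 1 (by omega) (by omega)
    simp [h2] at this
  · exact hs j h hj

open Classical in
/-- For a closed polygon of total turning `2π` with exactly three left turns, reversing the edge
vectors after each left turn gives vectors sorted clockwise within a half-turn: the line carrying
the edge rotates clockwise throughout, by `2π - 3π = -π` in total. -/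
theorem exists_signs_sorted {k : ℕ} (e : ℕ → Plane) (hc : ∀ i, i < k → cross (e i) (e (i + 1)) ≠ 0)
    (hsum : ∑ i ∈ Finset.range k, turn (e i) (e (i + 1)) = 2 * Real.pi)
    (hthree : ((Finset.range k).filter fun i => 0 < cross (e i) (e (i + 1))).card = 3) :
    ∃ ε : ℕ → ℝ, (∀ i, ε i * ε i = 1) ∧
      ∀ i j, i < j → j < k → cross (ε i • e i) (ε j • e j) < 0 := by
  set σ : ℕ → ℝ := fun i => if 0 < cross (e i) (e (i + 1)) then -1 else 1 with hσ
  set ρ : ℕ → ℝ := fun i => turn (e i) (e (i + 1)) -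
    if 0 < cross (e i) (e (i + 1)) then Real.pi else 0 with hρ
  set ε : ℕ → ℝ := fun i => ∏ l ∈ Finset.range i, σ l with hε
  have hσ1 : ∀ i, σ i * σ i = 1 := fun i => by simp only [hσ]; split_ifs <;> norm_num
  have hε1 : ∀ i, ε i * ε i = 1 := fun i => by
    simp only [hε]; rw [← Finset.prod_mul_distrib]; simp [hσ1]
  have hρneg : ∀ i, i < k → ρ i < 0 := fun i hi => by
    have h1 := hc i hi
    simp only [hρ]
    split_ifs with h
    · linarith [turn_lt_pi h1]
    · rw [sub_zero]; exact turn_neg_iff.2 (lt_of_le_of_ne (not_lt.1 h) h1)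
  have hρsum : ∑ i ∈ Finset.range k, ρ i = -Real.pi := by
    simp only [hρ]
    rw [Finset.sum_sub_distrib, hsum, ← Finset.sum_filter, Finset.sum_const, hthree]
    simp; ring
  have hne : ∀ i, i < k → e i ≠ 0 := fun i hi h => hc i hi (by simp [h])
  -- The quotient of two consecutive signed edges has argument `ρ`.
  have hstep : ∀ i, i < k → ∃ r : ℝ, 0 < r ∧
      conjMul (ε i • e i) (ε (i + 1) • e (i + 1)) = r * Complex.exp (ρ i * Complex.I) := by
    intro i hi
    refine ⟨‖conjMul (e i) (e (i + 1))‖, norm_pos_iff.2 fun h => hc i hi ?_, ?_⟩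
    · have := congrArg Complex.im h; simpa [conjMul] using this
    · have h1 : conjMul (ε i • e i) (ε (i + 1) • e (i + 1)) =
          ((σ i : ℝ) : ℂ) * conjMul (e i) (e (i + 1)) := by
        have h2 : ε (i + 1) = ε i * σ i := by simp only [hε]; rw [Finset.prod_range_succ]
        have h3 := hε1 i
        apply Complex.ext
        · simp only [conjMul, inner_smul_left, inner_smul_right, h2, Complex.re_ofReal_mul,
            conj_trivial]
          linear_combination σ i * inner ℝ (e i) (e (i + 1)) * h3
        · simp only [conjMul, cross_smul_left, cross_smul_right, h2, Complex.im_ofReal_mul]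
          linear_combination σ i * cross (e i) (e (i + 1)) * h3
      have h4 := Complex.norm_mul_exp_arg_mul_I (conjMul (e i) (e (i + 1)))
      rw [h1]
      simp only [hσ, hρ, turn]
      split_ifs
      · rw [Complex.ofReal_sub, sub_mul, Complex.exp_sub, Complex.exp_pi_mul_I]
        rw [mul_div_assoc', h4]; push_cast; ring
      · rw [sub_zero, h4]; simp
  have hall : ∀ i m, i + m < k → 0 < m → ∃ r : ℝ, 0 < r ∧
      conjMul (ε i • e i) (ε (i + m) • e (i + m)) =
        r * Complex.exp (((∑ l ∈ Finset.Ico i (i + m), ρ l : ℝ) : ℂ) * Complex.I) := by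
    intro i m
    induction m with
    | zero => intro _ h; omega
    | succ m ih =>
      intro hm _
      obtain ⟨r₂, hr₂, h₂⟩ := hstep (i + m) (by omega)
      rcases Nat.eq_zero_or_pos m with rfl | h0
      · refine ⟨r₂, hr₂, ?_⟩
        simpa using h₂
      obtain ⟨r₁, hr₁, h₁⟩ := ih (by omega) h0
      have h3 := conjMul_mul_conjMul (ε i • e i) (ε (i + m) • e (i + m))
        (ε (i + m + 1) • e (i + m + 1))
      have hpos : 0 < inner ℝ (ε (i + m) • e (i + m)) (ε (i + m) • e (i + m)) := by
        apply real_inner_self_pos.2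
        refine smul_ne_zero (fun h => ?_) (hne _ (by omega))
        have := hε1 (i + m); rw [h] at this; norm_num at this
      set N := inner ℝ (ε (i + m) • e (i + m)) (ε (i + m) • e (i + m))
      refine ⟨r₁ * r₂ / N, by positivity, ?_⟩
      have hN : ((N : ℝ) : ℂ) ≠ 0 := by exact_mod_cast hpos.ne'
      rw [← add_assoc, Finset.sum_Ico_succ_top (by omega), Complex.ofReal_add, add_mul,
        Complex.exp_add]
      apply mul_left_cancel₀ hN
      rw [← h3, h₁, h₂]; push_cast; field_simp
  refine ⟨ε, hε1, fun i j hij hj => ?_⟩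
  obtain ⟨m, rfl⟩ : ∃ m, j = i + m := ⟨j - i, by omega⟩
  obtain ⟨r, hr, h⟩ := hall i m hj (by omega)
  have h1 := congrArg Complex.im h
  rw [Complex.im_ofReal_mul, Complex.exp_ofReal_mul_I_im] at h1
  have hlt : ∑ l ∈ Finset.Ico i (i + m), ρ l < 0 :=
    Finset.sum_neg (fun l hl => hρneg l (by rw [Finset.mem_Ico] at hl; omega))
      ⟨i, Finset.mem_Ico.2 ⟨le_rfl, hij⟩⟩
  have hgt : -Real.pi < ∑ l ∈ Finset.Ico i (i + m), ρ l := by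
    rw [← hρsum, ← neg_lt_neg_iff, ← Finset.sum_neg_distrib, ← Finset.sum_neg_distrib]
    refine Finset.sum_lt_sum_of_subset (i := i + m) ?_ (Finset.mem_range.2 hj) ?_ ?_ ?_
    · intro l hl; rw [Finset.mem_Ico] at hl; exact Finset.mem_range.2 (by omega)
    · simp
    · linarith [hρneg (i + m) hj]
    · intro l hl _; rw [Finset.mem_range] at hl; linarith [hρneg l hl]
  have h2 : cross (ε i • e i) (ε (i + m) • e (i + m)) =
      r * Real.sin (∑ l ∈ Finset.Ico i (i + m), ρ l) := h1
  rw [h2]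
  exact mul_neg_of_pos_of_neg hr (Real.sin_neg_of_neg_of_neg_pi_lt hlt hgt)

open Classical in
/-- The area form is positive definite on the parallel redrawings of a closed polygon of total
turning `2π` with exactly three left turns. -/
theorem area_form_of_three_left_turns {k : ℕ} (hk : 3 ≤ k) (e : ℕ → Plane)
    (hc : ∀ i, i < k → cross (e i) (e (i + 1)) ≠ 0)
    (hsum : ∑ i ∈ Finset.range k, turn (e i) (e (i + 1)) = 2 * Real.pi)
    (hthree : ((Finset.range k).filter fun i => 0 < cross (e i) (e (i + 1))).card = 3)
    (r : ℕ → Plane) (l : ℕ → ℝ) (hr : ∀ j, j < k → r (j + 1) = r j + l j • e j)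
    (hrk : r k = r 0) :
    0 ≤ ∑ j ∈ Finset.range k, cross (r j) (r (j + 1)) ∧
      (∑ j ∈ Finset.range k, cross (r j) (r (j + 1)) = 0 → ∀ j, j < k → l j = 0) := by
  obtain ⟨ε, hε, hs⟩ := exists_signs_sorted e hc hsum hthree
  have h := area_form_of_sorted hk (fun j => ε j • e j) (fun j => r j - r 0) (fun j => l j * ε j)
    hs (by simp) (by simp [hrk]) (fun j hj => by
      rw [smul_smul, mul_assoc, hε, mul_one, hr j hj]; abel)
  have e1 : ∑ j ∈ Finset.range k, cross (r j - r 0) (r (j + 1) - r 0) =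
      ∑ j ∈ Finset.range k, cross (r j) (r (j + 1)) := by
    have h2 : ∀ j, cross (r j - r 0) (r (j + 1) - r 0) = cross (r j) (r (j + 1)) -
        (cross (r 0) (r (j + 1)) - cross (r 0) (r j)) := fun j => by
      rw [cross_sub_left, cross_sub_right, cross_sub_right, cross_self, cross_swap (r j) (r 0)]
      ring
    simp only [h2]
    rw [Finset.sum_sub_distrib, Finset.sum_range_sub (fun j => cross (r 0) (r j)), hrk]
    ring
  rw [e1] at h
  refine ⟨h.1, fun h0 j hj => ?_⟩
  refine (mul_eq_zero.1 (h.2 h0 j hj)).resolve_right fun h3 => ?_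
  have := hε j; rw [h3] at this; norm_num at this

/-! ### The two sides of the edges of a simple polygon -/

theorem subset_of_disjoint_frontier {U C : Set Plane} (hU : IsOpen U) (hC : IsPreconnected C)
    (hd : Disjoint C (frontier U)) (hne : (C ∩ U).Nonempty) : C ⊆ U := by
  refine hC.subset_left_of_subset_union (v := (closure U)ᶜ) hU
    isClosed_closure.isOpen_compl ?_ ?_ hne
  · exact Set.disjoint_left.2 fun z hz hz' => hz' (subset_closure hz)
  · intro z hz
    by_cases h : z ∈ closure U
    · left
      by_contra h'
      exact Set.disjoint_left.1 hd hz ⟨h, by rwa [hU.interior_eq]⟩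
    · exact Or.inr h

theorem midpoint_apply (a b : Plane) (i : Fin 2) : midpoint ℝ a b i = (a i + b i) / 2 := by
  rw [midpoint_eq_smul_add]; simp; ring

theorem cross_pos_of_mem_segment {w x p y z : Plane} (hp : 0 < cross w (p - x))
    (hy : 0 < cross w (y - x)) (hz : z ∈ segment ℝ p y) : 0 < cross w (z - x) := by
  obtain ⟨α, β, hα, hβ, hab, rfl⟩ := hz
  have e : cross w (α • p + β • y - x) = α * cross w (p - x) + β * cross w (y - x) := by
    have hβ' : β = 1 - α := by linarith
    subst hβ'
    simp [cross]; ring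
  rw [e]
  rcases hα.eq_or_lt with rfl | h
  · rw [zero_add] at hab; subst hab; linarith
  · have := mul_pos h hp
    have := mul_nonneg hβ hy.le
    linarith

theorem cross_eq_zero_of_mem_segment {a b z : Plane} (hz : z ∈ segment ℝ a b) :
    cross (b - a) (z - a) = 0 ∧ cross (b - a) (z - b) = 0 := by
  obtain ⟨α, β, hα, hβ, hab, rfl⟩ := hz
  have hβ' : β = 1 - α := by linarith
  subst hβ'
  constructor <;> simp [cross] <;> ring

theorem tendsto_add_smul (x v : Plane) :
    Tendsto (fun t : ℝ => x + t • v) (𝓝[>] 0) (𝓝 x) := by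
  have : Continuous fun t : ℝ => x + t • v := by fun_prop
  have h := this.tendsto 0
  simp only [zero_smul, add_zero] at h
  exact h.mono_left nhdsWithin_le_nhds

/-- Near a corner `x` of a path `a, x, b`, the ray that leaves the midpoint of `[a, x]` on the side
`κ` is joined, without meeting the path or the closed set `Z`, to the ray from `x` that points into
the sector on the same side, i.e. along the sum of the two sides if this sector is convex and
opposite to it otherwise. -/
theorem corner_path {a x b : Plane} {Z : Set Plane} (hZ : IsClosed Z)
    (hd : Disjoint (segment ℝ (midpoint ℝ a x) x) Z) {κ σ : ℝ}
    (hσ : 0 < σ * κ * cross (x - a) (b - x)) :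
    ∃ T S : ℝ → Prop, (∀ᶠ t in 𝓝[>] 0, T t) ∧ (∀ᶠ s in 𝓝[>] 0, S s) ∧ ∀ t s, T t → S s →
      Disjoint (segment ℝ (midpoint ℝ a x + t • κ • J (x - a))
        (x + s • σ • ((a - x) + (b - x)))) (Z ∪ segment ℝ a x ∪ segment ℝ x b) := by
  obtain ⟨δ, hδ, hsub⟩ := (isCompact_segment (midpoint ℝ a x) x).exists_thickening_subset_open
    hZ.isOpen_compl hd.subset_compl_right
  set O := Metric.thickening δ (segment ℝ (midpoint ℝ a x) x) with hO
  have hOopen : IsOpen O := Metric.isOpen_thickening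
  have hOconv : Convex ℝ O := (convex_segment _ _).thickening δ
  have hp : midpoint ℝ a x ∈ O := Metric.self_subset_thickening hδ _ (left_mem_segment ℝ _ _)
  have hx : x ∈ O := Metric.self_subset_thickening hδ _ (right_mem_segment ℝ _ _)
  have hκ : κ ≠ 0 := by rintro rfl; simp at hσ
  have hxa : x - a ≠ 0 := by intro h; simp [h] at hσ
  have hxa' : 0 < inner ℝ (x - a) (x - a) := real_inner_self_pos.2 hxa
  set c := cross (x - a) (b - x) with hc
  have hT3 : ∀ᶠ t in 𝓝[>] (0 : ℝ), 0 < κ * c →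
      0 < cross (κ • (b - x)) (midpoint ℝ a x + t • κ • J (x - a) - x) := by
    by_cases hκc : 0 < κ * c
    · have hcont : Continuous fun z : Plane => cross (κ • (b - x)) (z - x) := by
        unfold cross; fun_prop
      have h0 : 0 < cross (κ • (b - x)) (midpoint ℝ a x - x) := by
        have : cross (κ • (b - x)) (midpoint ℝ a x - x) = κ * c / 2 := by
          simp [cross, hc]; ring
        rw [this]; linarith
      have h1 := (hcont.tendsto _).comp (tendsto_add_smul (midpoint ℝ a x) (κ • J (x - a)))
      filter_upwards [h1.eventually (lt_mem_nhds h0)] with t ht _ using ht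
    · exact Eventually.of_forall fun _ h => absurd h hκc
  refine ⟨fun t => 0 < t ∧ midpoint ℝ a x + t • κ • J (x - a) ∈ O ∧ (0 < κ * c →
      0 < cross (κ • (b - x)) (midpoint ℝ a x + t • κ • J (x - a) - x)),
    fun s => 0 < s ∧ x + s • σ • ((a - x) + (b - x)) ∈ O, ?_, ?_, ?_⟩
  · filter_upwards [self_mem_nhdsWithin, (tendsto_add_smul _ _).eventually (hOopen.mem_nhds hp),
      hT3] with t h1 h2 h3 using ⟨h1, h2, h3⟩
  · filter_upwards [self_mem_nhdsWithin, (tendsto_add_smul _ _).eventually (hOopen.mem_nhds hx)]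
      with t h1 h2 using ⟨h1, h2⟩
  · rintro t s ⟨ht, htO, ht3⟩ ⟨hs, hsO⟩
    rw [Set.disjoint_left]
    intro z hz hz'
    have hline : 0 < cross (κ • (x - a)) (z - x) := by
      refine cross_pos_of_mem_segment ?_ ?_ hz
      · have : cross (κ • (x - a)) (midpoint ℝ a x + t • κ • J (x - a) - x) =
            t * κ ^ 2 * inner ℝ (x - a) (x - a) := by
          rw [inner_eq]; simp [cross, midpoint_apply]; ring
        rw [this]; positivity
      · have : cross (κ • (x - a)) (x + s • σ • ((a - x) + (b - x)) - x) = s * (σ * κ * c) := by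
          simp [cross, hc]; ring
        rw [this]; positivity
    rcases hz' with (hz' | hz') | hz'
    · exact hsub (hOconv.segment_subset htO hsO hz) hz'
    · rw [cross_smul_left, (cross_eq_zero_of_mem_segment hz').2, mul_zero] at hline
      exact hline.ne rfl
    · rcases lt_or_ge 0 (κ * c) with hκc | hκc
      · have : 0 < cross (κ • (b - x)) (z - x) := by
          refine cross_pos_of_mem_segment (ht3 hκc) ?_ hz
          have : cross (κ • (b - x)) (x + s • σ • ((a - x) + (b - x)) - x) = s * (σ * κ * c) := by
            simp [cross, hc]; ring
          rw [this]; positivity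
        rw [cross_smul_left, (cross_eq_zero_of_mem_segment hz').1, mul_zero] at this
        exact this.ne rfl
      · obtain ⟨α, β, hα, hβ, hab, rfl⟩ := hz'
        have : cross (κ • (x - a)) (α • x + β • b - x) = β * (κ * c) := by
          have hα' : α = 1 - β := by linarith
          subst hα'
          simp [cross, hc]; ring
        rw [this] at hline
        nlinarith

theorem notMem_segment_midpoint {a b : Plane} (h : a ≠ b) : a ∉ segment ℝ (midpoint ℝ a b) b := by
  rintro ⟨α, β, hα, hβ, hab, e⟩
  have hpos : α / 2 + β ≠ 0 := by
    rcases hα.eq_or_lt with h | h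
    · linarith
    · have : 0 < α / 2 + β := by linarith
      exact this.ne'
  have hα' : α = 1 - β := by linarith
  have hi : ∀ i, a i = b i := fun i => by
    have := congrArg (fun z : Plane => z i) e
    simp only [PiLp.add_apply, PiLp.smul_apply, smul_eq_mul, midpoint_apply] at this
    apply mul_left_cancel₀ hpos
    subst hα'
    linarith
  exact h (ext_coords (hi 0) (hi 1))

/-- `U` contains all points close to the midpoint of `[a, b]` on the perpendicular ray to the left
(for `κ = 1`) or to the right (for `κ = -1`) of the direction from `a` to `b`. -/
def OnSide (U : Set Plane) (κ : ℝ) (a b : Plane) : Prop :=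
  ∀ᶠ t : ℝ in 𝓝[>] 0, midpoint ℝ a b + t • κ • J (b - a) ∈ U

theorem onSide_neg_swap (U : Set Plane) (κ : ℝ) (a b : Plane) :
    OnSide U (-κ) b a ↔ OnSide U κ a b := by
  unfold OnSide
  rw [midpoint_comm, ← neg_sub b a, map_neg]
  simp only [neg_smul, smul_neg, neg_neg]

theorem onSide_iff_corner {U : Set Plane} (hU : IsOpen U) {a x b : Plane} {Z : Set Plane}
    (hZ : IsClosed Z) (hfr : frontier U ⊆ Z ∪ segment ℝ a x ∪ segment ℝ x b)
    (hd : Disjoint (segment ℝ (midpoint ℝ a x) x) Z) {κ σ : ℝ}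
    (hσ : 0 < σ * κ * cross (x - a) (b - x)) :
    OnSide U κ a x ↔ ∀ᶠ s : ℝ in 𝓝[>] 0, x + s • σ • ((a - x) + (b - x)) ∈ U := by
  obtain ⟨T, S, hT, hS, h⟩ := corner_path hZ hd hσ
  have key : ∀ t s, T t → S s → (midpoint ℝ a x + t • κ • J (x - a) ∈ U ↔
      x + s • σ • ((a - x) + (b - x)) ∈ U) := by
    intro t s ht hs
    have hdis := (h t s ht hs).mono_right hfr
    have hpre := (convex_segment (𝕜 := ℝ) (midpoint ℝ a x + t • κ • J (x - a))
      (x + s • σ • ((a - x) + (b - x)))).isPreconnected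
    exact ⟨fun h1 => subset_of_disjoint_frontier hU hpre hdis
        ⟨_, left_mem_segment ℝ _ _, h1⟩ (right_mem_segment ℝ _ _),
      fun h1 => subset_of_disjoint_frontier hU hpre hdis
        ⟨_, right_mem_segment ℝ _ _, h1⟩ (left_mem_segment ℝ _ _)⟩
  constructor
  · intro h1
    obtain ⟨t, ht, ht'⟩ := (hT.and h1).exists
    filter_upwards [hS] with s hs using (key t s ht hs).1 ht'
  · intro h1
    obtain ⟨s, hs, hs'⟩ := (hS.and h1).exists
    filter_upwards [hT] with t ht using (key t s ht hs).2 hs'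

end Plane

open Plane

theorem ZMod.two_ne_zero_of_three_le {k : ℕ} (hk : 3 ≤ k) : (2 : ZMod k) ≠ 0 := by
  intro h
  have : ((2 : ℕ) : ZMod k) = 0 := by exact_mod_cast h
  rw [ZMod.natCast_eq_zero_iff] at this
  have := Nat.le_of_dvd (by norm_num) this
  omega

theorem ZMod.one_ne_zero_of_three_le {k : ℕ} (hk : 3 ≤ k) : (1 : ZMod k) ≠ 0 := by
  intro h
  have : ((1 : ℕ) : ZMod k) = 0 := by exact_mod_cast h
  rw [ZMod.natCast_eq_zero_iff] at this
  have := Nat.le_of_dvd (by norm_num) this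
  omega

theorem ZMod.sum_range_add {k : ℕ} [NeZero k] (f : ZMod k → ℝ) (s : ZMod k) :
    ∑ n ∈ Finset.range k, f (s + n) = ∑ i, f i := by
  refine Finset.sum_nbij' (fun n => s + (n : ZMod k)) (fun i => (i - s).val) ?_ ?_ ?_ ?_ ?_
  · intro n _; exact Finset.mem_univ _
  · intro i _; exact Finset.mem_range.2 (ZMod.val_lt _)
  · intro n hn
    simp [ZMod.val_cast_of_lt (Finset.mem_range.1 hn)]
  · intro i _; simp
  · intro n _; rfl

section Polygon

variable {k : ℕ} {q : ZMod k → Plane} {U : Set Plane}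

namespace IsSimplePolygon

/-- The half of a side next to its second endpoint only meets this side and the following one. -/
theorem disjoint_half_side (hq : IsSimplePolygon q) (i : ZMod k) :
    Disjoint (segment ℝ (midpoint ℝ (q i) (q (i + 1))) (q (i + 1)))
      (⋃ j ∈ ({i, i + 1} : Set (ZMod k))ᶜ, segment ℝ (q j) (q (j + 1))) := by
  rw [Set.disjoint_left]
  intro z hz hz'
  simp only [mem_iUnion, mem_compl_iff, mem_insert_iff, mem_singleton_iff, not_or] at hz'
  obtain ⟨j, ⟨hj1, hj2⟩, hzj⟩ := hz'
  have hzi : z ∈ segment ℝ (q i) (q (i + 1)) :=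
    (convex_segment _ _).segment_subset (_root_.midpoint_mem_segment _ _)
      (right_mem_segment ℝ _ _) hz
  by_cases h : i = j + 1
  · subst h
    have h4 : z ∈ ({q (j + 1)} : Set Plane) := by
      rw [← hq.2.2.1 j]
      exact ⟨hzj, by rwa [show j + 2 = j + 1 + 1 by ring]⟩
    rw [mem_singleton_iff] at h4
    subst h4
    refine notMem_segment_midpoint (fun h => ZMod.one_ne_zero_of_three_le hq.1 ?_) hz
    simpa using (hq.2.1 h).symm
  · exact Set.disjoint_left.1 (hq.2.2.2 i j (Ne.symm hj1) hj2 h) hzi hzj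

theorem reverse (hq : IsSimplePolygon q) : IsSimplePolygon fun i => q (-i) := by
  refine ⟨hq.1, hq.2.1.comp neg_injective, fun i => ?_, fun i j hij h1 h2 => ?_⟩
  · have := hq.2.2.1 (-i - 2)
    rw [inter_comm, segment_symm ℝ (q (-i - 2 + 1)), segment_symm ℝ (q (-i - 2))] at this
    convert this using 2 <;> ring_nf
  · have := hq.2.2.2 (-i - 1) (-j - 1) (fun h => hij (by simpa using h))
      (fun h => h2 (by linear_combination h)) (fun h => h1 (by linear_combination h))
    rw [segment_symm, segment_symm ℝ (q (-j - 1))] at this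
    convert this using 2 <;> ring_nf

theorem isClosed_biUnion_sides (hq : IsSimplePolygon q) (s : Set (ZMod k)) :
    IsClosed (⋃ j ∈ s, segment ℝ (q j) (q (j + 1))) := by
  have : NeZero k := ⟨by have := hq.1; omega⟩
  exact (Set.toFinite s).isClosed_biUnion fun j _ => (isCompact_segment _ _).isClosed

/-- Whether `U` lies on the side `κ` of a side of a simple polygon can be tested at its second
endpoint. -/
theorem onSide_iff_next (hq : IsSimplePolygon q) (hU : IsOpen U)
    (hfr : frontier U = ⋃ i, segment ℝ (q i) (q (i + 1))) (i : ZMod k) {κ σ : ℝ}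
    (hσ : 0 < σ * κ * cross (q (i + 1) - q i) (q (i + 2) - q (i + 1))) :
    OnSide U κ (q i) (q (i + 1)) ↔
      ∀ᶠ s : ℝ in 𝓝[>] 0,
        q (i + 1) + s • σ • ((q i - q (i + 1)) + (q (i + 2) - q (i + 1))) ∈ U := by
  refine onSide_iff_corner hU (hq.isClosed_biUnion_sides _) ?_ (hq.disjoint_half_side i) hσ
  rw [hfr]
  refine iUnion_subset fun j => ?_
  rw [show i + 2 = i + 1 + 1 by ring]
  by_cases h1 : j = i
  · subst h1; exact subset_union_of_subset_left subset_union_right _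
  by_cases h2 : j = i + 1
  · subst h2; exact subset_union_right
  · refine subset_union_of_subset_left (subset_union_of_subset_left ?_ _) _
    exact subset_biUnion_of_mem (u := fun j => segment ℝ (q j) (q (j + 1)))
      (show j ∈ ({i, i + 1} : Set (ZMod k))ᶜ by simp [h1, h2])

theorem iUnion_reverse (q : ZMod k → Plane) :
    ⋃ i : ZMod k, segment ℝ (q (-i)) (q (-(i + 1))) = ⋃ i, segment ℝ (q i) (q (i + 1)) := by
  apply subset_antisymm
  · refine iUnion_subset fun i => ?_
    rw [segment_symm]
    have := subset_iUnion (fun i => segment ℝ (q i) (q (i + 1))) (-(i + 1))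
    simpa using this
  · refine iUnion_subset fun i => ?_
    rw [segment_symm]
    have := subset_iUnion (fun i : ZMod k => segment ℝ (q (-i)) (q (-(i + 1)))) (-(i + 1))
    simpa using this

/-- Whether `U` lies on the side `κ` of a side of a simple polygon can be tested at its first
endpoint. -/
theorem onSide_next_iff (hq : IsSimplePolygon q) (hU : IsOpen U)
    (hfr : frontier U = ⋃ i, segment ℝ (q i) (q (i + 1))) (i : ZMod k) {κ σ : ℝ}
    (hσ : 0 < σ * κ * cross (q (i + 1) - q i) (q (i + 2) - q (i + 1))) :
    OnSide U κ (q (i + 1)) (q (i + 2)) ↔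
      ∀ᶠ s : ℝ in 𝓝[>] 0,
        q (i + 1) + s • σ • ((q i - q (i + 1)) + (q (i + 2) - q (i + 1))) ∈ U := by
  have h := hq.reverse.onSide_iff_next hU (by rw [hfr, iUnion_reverse]) (-(i + 2)) (κ := -κ)
    (σ := σ)
  have e1 : -(-(i + 2) + 1) = i + 1 := by ring
  have e2 : -(-(i + 2) + 2) = i := by ring
  simp only [e1, e2, neg_neg] at h
  rw [← onSide_neg_swap, h, add_comm (q i - q (i + 1))]
  rw [← neg_sub (q (i + 1)), ← neg_sub (q (i + 2)), cross_neg_left, cross_neg_right, neg_neg,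
    cross_swap]
  linarith

theorem onSide_iff_onSide_zero (hq : IsSimplePolygon q) (hU : IsOpen U)
    (hfr : frontier U = ⋃ i, segment ℝ (q i) (q (i + 1)))
    (hc : ∀ i, cross (q (i + 1) - q i) (q (i + 2) - q (i + 1)) ≠ 0) {κ : ℝ} (hκ : κ ≠ 0)
    (i : ZMod k) : OnSide U κ (q i) (q (i + 1)) ↔ OnSide U κ (q 0) (q (0 + 1)) := by
  have : NeZero k := ⟨by have := hq.1; omega⟩
  have hn : ∀ n : ℕ, OnSide U κ (q (n : ZMod k)) (q (n + 1)) ↔ OnSide U κ (q 0) (q (0 + 1)) := by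
    intro n
    induction n with
    | zero => simp
    | succ n ih =>
      have hσ : 0 < κ * cross (q ((n : ZMod k) + 1) - q n) (q (n + 2) - q (n + 1)) * κ *
          cross (q ((n : ZMod k) + 1) - q n) (q (n + 2) - q (n + 1)) := by
        have := mul_self_pos.2 (mul_ne_zero hκ (hc n))
        linarith
      rw [← ih, hq.onSide_iff_next hU hfr _ hσ, ← hq.onSide_next_iff hU hfr _ hσ]
      push_cast
      rw [show (n : ZMod k) + 1 + 1 = n + 2 by ring]
  have := hn i.val
  rwa [ZMod.natCast_zmod_val] at this

/-- A vertex farthest from the origin is strictly supported by the perpendicular line. -/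
theorem exists_supporting_vertex (hq : IsSimplePolygon q) :
    ∃ (i₀ : ZMod k) (n : Plane), ∀ j, j ≠ i₀ → 0 < inner ℝ n (q j - q i₀) := by
  have : NeZero k := ⟨by have := hq.1; omega⟩
  obtain ⟨i₀, h⟩ := Finite.exists_max fun i => ‖q i‖
  refine ⟨i₀, -q i₀, fun j hj => ?_⟩
  have h1 : 0 < ‖q j - q i₀‖ := norm_pos_iff.2 (sub_ne_zero.2 fun h => hj (hq.2.1 h))
  have h2 := norm_sub_sq_real (q j) (q i₀)
  have h3 : ‖q j‖ ^ 2 ≤ ‖q i₀‖ ^ 2 := by gcongr; exact h j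
  rw [inner_neg_left, inner_sub_right, real_inner_self_eq_norm_sq, real_inner_comm]
  nlinarith [pow_pos h1 2]

/-- A region bounded by a simple polygon does not meet an open half-plane that avoids the
polygon. -/
theorem _root_.IsPolygonInterior.notMem_of_inner_neg (hU : IsPolygonInterior q U) {i₀ : ZMod k}
    {n : Plane} (hn : ∀ j, j ≠ i₀ → 0 < inner ℝ n (q j - q i₀)) {z : Plane}
    (hz : inner ℝ n (z - q i₀) < 0) : z ∉ U := by
  intro hzU
  obtain ⟨hUo, -, hUb, hfr⟩ := hU
  have hn' : ∀ j, 0 ≤ inner ℝ n (q j - q i₀) := fun j => by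
    by_cases h : j = i₀
    · simp [h]
    · exact (hn j h).le
  have hlin : ∀ x y : Plane, ∀ α β : ℝ, α + β = 1 → inner ℝ n (α • x + β • y - q i₀) =
      α * inner ℝ n (x - q i₀) + β * inner ℝ n (y - q i₀) := by
    intro x y α β h
    have hβ : β = 1 - α := by linarith
    subst hβ
    simp only [inner_sub_right, inner_add_right, inner_smul_right]; ring
  have hn0 : n ≠ 0 := by rintro rfl; simp at hz
  set H : Set Plane := {w | inner ℝ n (w - q i₀) < 0} with hH
  have hHc : Convex ℝ H := by
    intro x hx y hy α β hα hβ hab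
    simp only [hH, mem_ofPred_eq] at hx hy ⊢
    rw [hlin _ _ _ _ hab]
    rcases hα.eq_or_lt with rfl | h
    · rw [zero_add] at hab; subst hab; linarith
    · nlinarith [mul_pos_of_neg_of_neg hx (neg_lt_zero.2 h)]
  have hHU : H ⊆ U := by
    refine subset_of_disjoint_frontier hUo hHc.isPreconnected ?_ ⟨z, hz, hzU⟩
    rw [hfr, Set.disjoint_left]
    intro w hw hw'
    obtain ⟨j, α, β, hα, hβ, hab, rfl⟩ := mem_iUnion.1 hw'
    simp only [hH, mem_ofPred_eq] at hw
    rw [hlin _ _ _ _ hab] at hw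
    linarith [mul_nonneg hα (hn' j), mul_nonneg hβ (hn' (j + 1))]
  obtain ⟨R, hR⟩ := hUb.subset_closedBall (q i₀)
  have hnpos : 0 < ‖n‖ := norm_pos_iff.2 hn0
  -- A point of the half-plane at distance `|R| + 1` from the supporting vertex.
  set w := q i₀ - ((|R| + 1) / ‖n‖) • n with hw
  have hwU : w ∈ U := by
    apply hHU
    simp only [hH, mem_ofPred_eq, hw, sub_sub_cancel_left, inner_neg_right, inner_smul_right,
      real_inner_self_eq_norm_sq]
    have : 0 < (|R| + 1) / ‖n‖ * ‖n‖ ^ 2 := by positivity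
    linarith
  have h1 := hR hwU
  rw [Metric.mem_closedBall, dist_eq_norm, hw, sub_sub_cancel_left, norm_neg, norm_smul,
    Real.norm_of_nonneg (by positivity), div_mul_cancel₀ _ hnpos.ne'] at h1
  linarith [le_abs_self R]

/-- Near the midpoint of a side, the interior of a simple polygon lies on one of the two sides. -/
theorem onSide_or_onSide (hq : IsSimplePolygon q) (hU : IsPolygonInterior q U) (i : ZMod k) :
    OnSide U 1 (q i) (q (i + 1)) ∨ OnSide U (-1) (q i) (q (i + 1)) := by
  obtain ⟨hUo, -, -, hfr⟩ := hU
  set m := midpoint ℝ (q i) (q (i + 1)) with hm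
  set e := q (i + 1) - q i with he
  have hne : q i ≠ q (i + 1) := fun h =>
    ZMod.one_ne_zero_of_three_le hq.1 (by simpa using (hq.2.1 h).symm)
  have hepos : 0 < inner ℝ e e := real_inner_self_pos.2 (sub_ne_zero.2 hne.symm)
  set Z := ⋃ j ∈ ({i}ᶜ : Set (ZMod k)), segment ℝ (q j) (q (j + 1)) with hZ
  have hmseg : m ∈ segment ℝ (q i) (q (i + 1)) := _root_.midpoint_mem_segment _ _
  have hmZ : m ∈ Zᶜ := by
    intro h
    simp only [hZ, mem_iUnion, mem_compl_iff, mem_singleton_iff] at h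
    obtain ⟨j, hj, hmj⟩ := h
    by_cases hj1 : j = i + 1
    · subst hj1
      have : m ∈ ({q (i + 1)} : Set Plane) := by
        rw [← hq.2.2.1 i]; exact ⟨hmseg, by rwa [show i + 2 = i + 1 + 1 by ring]⟩
      rw [mem_singleton_iff, hm, midpoint_eq_right_iff] at this
      exact hne this
    · refine Set.disjoint_left.1 (hq.disjoint_half_side i) (left_mem_segment ℝ _ _) ?_
      simp only [mem_iUnion, mem_compl_iff, mem_insert_iff, mem_singleton_iff, not_or]
      exact ⟨j, ⟨hj, hj1⟩, hmj⟩
  obtain ⟨δ, hδ, hball⟩ := Metric.isOpen_iff.1 (hq.isClosed_biUnion_sides {i}ᶜ).isOpen_compl m hmZ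
  have hfr' : frontier U ⊆ Z ∪ segment ℝ (q i) (q (i + 1)) := by
    rw [hfr]
    refine iUnion_subset fun j => ?_
    by_cases h : j = i
    · subst h; exact subset_union_right
    · exact subset_union_of_subset_left
        (subset_biUnion_of_mem (u := fun j => segment ℝ (q j) (q (j + 1)))
          (show j ∈ ({i}ᶜ : Set (ZMod k)) by simpa using h)) _
  -- A point of `U` near the midpoint on one side of the line spreads to the ray on this side.
  have key : ∀ κ : ℝ, κ ≠ 0 → ∀ z ∈ U, z ∈ Metric.ball m δ → 0 < cross (κ • e) (z - q i) →
      OnSide U κ (q i) (q (i + 1)) := by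
    intro κ hκ z hzU hzb hz
    filter_upwards [self_mem_nhdsWithin, (tendsto_add_smul m (κ • J e)).eventually
      (Metric.isOpen_ball.mem_nhds (Metric.mem_ball_self hδ))] with t ht htb
    rw [mem_Ioi] at ht
    have hp : 0 < cross (κ • e) (m + t • κ • J e - q i) := by
      have : cross (κ • e) (m + t • κ • J e - q i) = t * κ ^ 2 * inner ℝ e e := by
        rw [inner_eq]; simp [cross, hm, he, midpoint_apply]; ring
      rw [this]; positivity
    refine subset_of_disjoint_frontier hUo (convex_segment (𝕜 := ℝ) z _).isPreconnected ?_
      ⟨z, left_mem_segment ℝ _ _, hzU⟩ (right_mem_segment ℝ _ _)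
    refine Disjoint.mono_right hfr' (Set.disjoint_left.2 fun w hw hw' => ?_)
    rcases hw' with hw' | hw'
    · exact hball ((convex_ball m δ).segment_subset hzb htb hw) hw'
    · have := cross_pos_of_mem_segment hz hp hw
      rw [cross_smul_left, (cross_eq_zero_of_mem_segment hw').1, mul_zero] at this
      exact this.ne rfl
  have hmfr : m ∈ closure U := frontier_subset_closure (by
    rw [hfr]; exact mem_iUnion.2 ⟨i, hmseg⟩)
  obtain ⟨z, hzb, hzU⟩ := mem_closure_iff.1 hmfr _ Metric.isOpen_ball (Metric.mem_ball_self hδ)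
  rcases lt_or_ge (cross e (z - q i)) 0 with h | h
  · right
    exact key (-1) (by norm_num) z hzU hzb (by rw [cross_smul_left]; linarith)
  · left
    obtain ⟨t, ht, htU, htb⟩ := ((eventually_mem_nhdsWithin (a := (0 : ℝ)) (s := Ioi 0)).and
      (((tendsto_add_smul z (J e)).eventually (hUo.mem_nhds hzU)).and
      ((tendsto_add_smul z (J e)).eventually (Metric.isOpen_ball.mem_nhds hzb)))).exists
    rw [mem_Ioi] at ht
    refine key 1 one_ne_zero _ htU htb ?_
    rw [one_smul, add_sub_right_comm, cross_add_right, cross_smul_right, cross_J]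
    have := mul_pos ht hepos
    linarith

/-- If a simple polygon turns left at a supporting vertex, its interior lies to the left of every
side, and not to the right. -/
theorem onSide_of_left_turn (hq : IsSimplePolygon q) (hU : IsPolygonInterior q U)
    (hc : ∀ i, cross (q (i + 1) - q i) (q (i + 2) - q (i + 1)) ≠ 0) {i₀ : ZMod k} {n : Plane}
    (hn : ∀ j, j ≠ i₀ + 1 → 0 < inner ℝ n (q j - q (i₀ + 1)))
    (hleft : 0 < cross (q (i₀ + 1) - q i₀) (q (i₀ + 2) - q (i₀ + 1))) (i : ZMod k) :
    OnSide U 1 (q i) (q (i + 1)) ∧ ¬OnSide U (-1) (q i) (q (i + 1)) := by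
  have hright : ∀ i, ¬OnSide U (-1) (q i) (q (i + 1)) := by
    intro i
    rw [hq.onSide_iff_onSide_zero hU.1 hU.2.2.2 hc (by norm_num) i,
      ← hq.onSide_iff_onSide_zero hU.1 hU.2.2.2 hc (by norm_num) i₀,
      hq.onSide_iff_next hU.1 hU.2.2.2 i₀ (σ := -1) (by linarith)]
    intro h
    obtain ⟨s, hs, hsU⟩ := ((eventually_mem_nhdsWithin (a := (0 : ℝ)) (s := Ioi 0)).and h).exists
    rw [mem_Ioi] at hs
    refine hU.notMem_of_inner_neg hn ?_ hsU
    have h1 := hn i₀ (fun h => ZMod.one_ne_zero_of_three_le hq.1 (by simpa using h.symm))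
    have h2 := hn (i₀ + 2) (fun h => ZMod.one_ne_zero_of_three_le hq.1
      (by linear_combination h))
    rw [add_sub_cancel_left, smul_smul, inner_smul_right, inner_add_right]
    have := mul_pos hs (add_pos h1 h2)
    linarith
  exact ⟨(hq.onSide_or_onSide hU i).resolve_right (hright i), hright i⟩

end IsSimplePolygon
end Polygon

/-! ### Pseudo-triangles and their area form -/

section PseudoTriangle

variable {k : ℕ} {q : ZMod k → Plane} {U : Set Plane}

theorem internalAngle_swap (U : Set Plane) (a x b : Plane) :
    internalAngle U a x b = internalAngle U b x a := by
  unfold internalAngle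
  rw [add_comm (a - x), EuclideanGeometry.angle_comm]

theorem angle_lt_pi_of_cross_ne_zero {a x b : Plane} (h : cross (x - a) (b - x) ≠ 0) :
    EuclideanGeometry.angle a x b < Real.pi := by
  refine lt_of_le_of_ne (EuclideanGeometry.angle_le_pi _ _ _) fun e => ?_
  obtain ⟨-, r, -, hr⟩ := InnerProductGeometry.angle_eq_pi_iff.1 e
  rw [vsub_eq_sub, vsub_eq_sub] at hr
  apply h
  rw [hr, ← neg_sub a x, cross_smul_right, cross_neg_left, cross_self]
  simp

theorem IsPseudoTriangle.reverse (h : IsPseudoTriangle q U) :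
    IsPseudoTriangle (fun i => q (-i)) U := by
  obtain ⟨hq, ⟨hU1, hU2, hU3, hU4⟩, h3⟩ := h
  refine ⟨hq.reverse, ⟨hU1, hU2, hU3, by rw [hU4, IsSimplePolygon.iUnion_reverse]⟩, ?_⟩
  rw [← h3, ← Set.ncard_image_of_injective _ (neg_injective (G := ZMod k))]
  congr 1
  ext i
  simp only [mem_image, mem_ofPred_eq]
  constructor
  · rintro ⟨j, hj, rfl⟩
    rw [internalAngle_swap]
    convert hj using 3 <;> ring_nf
  · intro hi
    refine ⟨-i, ?_, neg_neg i⟩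
    rw [internalAngle_swap]
    convert hi using 3 <;> ring_nf

/-- If the interior of a polygon lies to the left of its sides, its internal angles smaller than `π`
are those at the left turns. -/
theorem IsSimplePolygon.internalAngle_lt_pi_iff (hq : IsSimplePolygon q)
    (hU : IsPolygonInterior q U)
    (hc : ∀ i, cross (q (i + 1) - q i) (q (i + 2) - q (i + 1)) ≠ 0)
    (hside : ∀ i, OnSide U 1 (q i) (q (i + 1)) ∧ ¬OnSide U (-1) (q i) (q (i + 1))) (i : ZMod k) :
    internalAngle U (q i) (q (i + 1)) (q (i + 2)) < Real.pi ↔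
      0 < cross (q (i + 1) - q i) (q (i + 2) - q (i + 1)) := by
  have ha := angle_lt_pi_of_cross_ne_zero (hc i)
  rcases lt_or_gt_of_ne (hc i) with h | h
  · have h1 := hq.onSide_iff_next hU.1 hU.2.2.2 i (κ := -1) (σ := 1) (by linarith)
    simp only [one_smul] at h1
    rw [internalAngle, if_neg fun h2 => (hside i).2 (h1.2 h2)]
    constructor <;> intro <;> linarith
  · have h1 := hq.onSide_iff_next hU.1 hU.2.2.2 i (κ := 1) (σ := 1) (by linarith)
    simp only [one_smul] at h1
    rw [internalAngle, if_pos (h1.1 (hside i).1)]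
    exact ⟨fun _ => h, fun _ => ha⟩

/-- The polygon `q` runs counterclockwise around the pseudo-triangle `U`, and its area form is
positive definite: every closed polygon `r` with sides parallel to those of `q` has nonnegative
area, and the area is positive unless `r` is a point. The sum is twice the signed area; it may start
at any vertex `s`. -/
def IsOrientedPseudoTriangle (q : ZMod k → Plane) (U : Set Plane) : Prop :=
  3 ≤ k ∧ Function.Injective q ∧
  (∀ i, OnSide U 1 (q i) (q (i + 1)) ∧ ¬OnSide U (-1) (q i) (q (i + 1))) ∧
  ∀ (r : ZMod k → Plane) (l : ZMod k → ℝ), (∀ i, r (i + 1) = r i + l i • (q (i + 1) - q i)) →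
    ∀ s : ZMod k, 0 ≤ ∑ j ∈ Finset.range k, cross (r (s + j)) (r (s + j + 1)) ∧
      (∑ j ∈ Finset.range k, cross (r (s + j)) (r (s + j + 1)) = 0 → ∀ i, l i = 0)

open Classical in
theorem IsPseudoTriangle.isOriented_of_left_turn (h : IsPseudoTriangle q U)
    (hc : ∀ i, cross (q (i + 1) - q i) (q (i + 2) - q (i + 1)) ≠ 0) {i₀ : ZMod k} {n : Plane}
    (hn : ∀ j, j ≠ i₀ + 1 → 0 < inner ℝ n (q j - q (i₀ + 1)))
    (hleft : 0 < cross (q (i₀ + 1) - q i₀) (q (i₀ + 2) - q (i₀ + 1))) :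
    IsOrientedPseudoTriangle q U := by
  obtain ⟨hq, hU, h3⟩ := h
  have hside := hq.onSide_of_left_turn hU hc hn hleft
  have hk := hq.1
  have : NeZero k := ⟨by omega⟩
  refine ⟨hk, hq.2.1, hside, fun r l hr s => ?_⟩
  rw [ZMod.sum_range_add (fun i => cross (r i) (r (i + 1))),
    ← ZMod.sum_range_add (fun i => cross (r i) (r (i + 1))) (i₀ + 1)]
  -- The polygon is enumerated from the supporting vertex.
  set v : ℕ → ZMod k := fun m => i₀ + 1 + m with hv
  have hv1 : ∀ m, v (m + 1) = v m + 1 := fun m => by simp only [hv]; push_cast; ring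
  have hv2 : ∀ m, v (m + 2) = v m + 2 := fun m => by simp only [hv]; push_cast; ring
  have hv0 : v 0 = i₀ + 1 := by simp [hv]
  have hvk : v k = v 0 := by simp [hv]
  have hvk1 : v (k + 1) = v 1 := by simp [hv]
  have hinj : ∀ a b, a < k → b < k → v a = v b → a = b := fun a b ha hb e => by
    simp only [hv, add_right_inj] at e
    rw [← ZMod.val_cast_of_lt ha, e, ZMod.val_cast_of_lt hb]
  have hpred : v (k - 1) = i₀ := by
    simp only [hv]; rw [Nat.cast_sub (by omega)]; simp
  have hcv : ∀ m, cross (q (v (m + 1)) - q (v m)) (q (v (m + 2)) - q (v (m + 1))) ≠ 0 := fun m => by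
    rw [hv1, hv2]; exact hc _
  have hsum := sum_turn_eq_two_pi (fun m => q (v m)) (k := k) hk (by rw [hvk]) (by rw [hvk1])
    (fun a b hab hb hne => by
      rw [hv1, hv1]
      refine hq.2.2.2 _ _ (fun e => ?_) (fun e => ?_) (fun e => ?_)
      · have := hinj _ _ (by omega) hb e; omega
      · rw [← hv1] at e
        have := hinj _ _ hb (by omega) e; omega
      · rw [← hv1] at e
        rcases Nat.lt_or_ge (b + 1) k with h | h
        · have := hinj _ _ (by omega) h e; omega
        · have hbk : b + 1 = k := by omega
          rw [hbk, hvk] at e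
          have := hinj _ _ (by omega) (by omega) e
          omega)
    (fun m _ => hcv m) (n := n)
    (fun j h0 hj => by
      rw [hv0]
      refine hn _ fun e => ?_
      rw [← hv0] at e
      have := hinj _ _ hj (by omega) e; omega)
    (by
      rw [hpred, hv1 0, hv0]
      have e : cross (q (i₀ + 1 + 1) - q (i₀ + 1)) (q i₀ - q (i₀ + 1)) =
          cross (q (i₀ + 1) - q i₀) (q (i₀ + 2) - q (i₀ + 1)) := by
        rw [show i₀ + 1 + 1 = i₀ + 2 by ring, ← neg_sub (q (i₀ + 1)) (q i₀), cross_neg_right,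
          cross_swap, neg_neg]
      rw [e]; exact hleft)
  have hthree : ((Finset.range k).filter fun m =>
      0 < cross (q (v (m + 1)) - q (v m)) (q (v (m + 1 + 1)) - q (v (m + 1)))).card = 3 := by
    rw [← h3, ← Set.ncard_coe_finset]
    have hinjOn : Set.InjOn (fun m => v m + 1) ((Finset.range k).filter fun m =>
      0 < cross (q (v (m + 1)) - q (v m)) (q (v (m + 1 + 1)) - q (v (m + 1))) : Set ℕ) := by
      intro a ha b hb e
      simp only [Finset.coe_filter, Finset.mem_range, mem_ofPred_eq] at ha hb
      exact hinj a b ha.1 hb.1 (add_right_cancel e)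
    rw [← hinjOn.ncard_image]
    congr 1
    have hiff := hq.internalAngle_lt_pi_iff hU hc hside
    ext i
    simp only [Finset.coe_filter, Finset.mem_range, mem_image, mem_ofPred_eq]
    constructor
    · rintro ⟨m, ⟨-, hm⟩, rfl⟩
      rw [show v m + 1 - 1 = v m by ring, show v m + 1 + 1 = v m + 2 by ring, hiff]
      rwa [hv1, hv2] at hm
    · intro hi
      have e : v (i - 1 - (i₀ + 1)).val = i - 1 := by
        simp only [hv]; rw [ZMod.natCast_zmod_val]; ring
      refine ⟨(i - 1 - (i₀ + 1)).val, ⟨ZMod.val_lt _, ?_⟩, ?_⟩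
      · rw [hv1, hv2, e, ← hiff]
        rwa [show i - 1 + 1 = i by ring, show i - 1 + 2 = i + 1 by ring]
      · rw [e]; ring
  have harea := area_form_of_three_left_turns hk (fun m => q (v (m + 1)) - q (v m))
    (fun m _ => hcv m) hsum hthree (fun m => r (v m)) (fun m => l (v m))
    (fun m _ => by rw [hv1]; exact hr _) (by rw [hvk])
  have e2 : ∀ m : ℕ, cross (r (v m)) (r (v (m + 1))) =
      cross (r (i₀ + 1 + m)) (r (i₀ + 1 + m + 1)) := fun m => by rw [hv1]
  simp only [e2] at harea
  refine ⟨harea.1, fun h0 i => ?_⟩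
  have := harea.2 h0 (i - (i₀ + 1)).val (ZMod.val_lt _)
  simp only [hv] at this
  rw [ZMod.natCast_zmod_val] at this
  rwa [show i₀ + 1 + (i - (i₀ + 1)) = i by ring] at this

/-- A pseudo-triangle without straight angles is oriented by its enumeration or by the reverse
enumeration. -/
theorem IsPseudoTriangle.isOriented_or_reverse (h : IsPseudoTriangle q U)
    (hc : ∀ i, cross (q (i + 1) - q i) (q (i + 2) - q (i + 1)) ≠ 0) :
    IsOrientedPseudoTriangle q U ∨ IsOrientedPseudoTriangle (fun i => q (-i)) U := by
  obtain ⟨j₀, n, hn⟩ := h.1.exists_supporting_vertex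
  obtain ⟨i₀, rfl⟩ : ∃ i₀, j₀ = i₀ + 1 := ⟨j₀ - 1, by ring⟩
  have hrev : ∀ i, cross (q (-(i + 1)) - q (-i)) (q (-(i + 2)) - q (-(i + 1))) =
      -cross (q (-(i + 2) + 1) - q (-(i + 2))) (q (-(i + 2) + 2) - q (-(i + 2) + 1)) := fun i => by
    rw [show -(i + 2) + 1 = -(i + 1) by ring, show -(i + 2) + 2 = -i by ring,
      ← neg_sub (q (-i)), ← neg_sub (q (-(i + 1))) (q (-(i + 2))), cross_neg_left, cross_neg_right,
      neg_neg, cross_swap]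
  rcases lt_or_gt_of_ne (hc i₀) with h1 | h1
  · right
    refine h.reverse.isOriented_of_left_turn (i₀ := -(i₀ + 2)) (n := n) (fun i => ?_)
      (fun j hj => ?_) ?_
    · rw [hrev]; exact neg_ne_zero.2 (hc _)
    · rw [show -(-(i₀ + 2) + 1) = i₀ + 1 by ring]
      exact hn _ fun e => hj (by linear_combination -e)
    · rw [hrev, show -(-(i₀ + 2) + 2) = i₀ by ring]
      linarith
  · exact Or.inl (h.isOriented_of_left_turn hc hn h1)

end PseudoTriangle

namespace PeriodicFramework

variable {V Γ : Type*} [AddCommGroup Γ] [AddAction Γ V] (F : PeriodicFramework V Γ)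

/-! ### The faces of a periodic pseudo-triangulation -/

theorem exists_period_basis : ∃ (b : Module.Basis (Fin 2) ℤ Γ) (B : Module.Basis (Fin 2) ℝ Plane),
    ∀ i, B i = F.period (b i) := by
  have := F.free_group
  have : Module.Finite ℤ Γ := Module.finite_of_finrank_pos (by rw [F.rank_two]; norm_num)
  let b : Module.Basis (Fin 2) ℤ Γ := Module.finBasisOfFinrankEq ℤ Γ F.rank_two
  have hspan : ⊤ ≤ Submodule.span ℝ (range fun i => F.period (b i)) := by
    rw [← F.period_span, Submodule.span_le]
    rintro _ ⟨γ, rfl⟩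
    have h : F.period γ = ∑ i, (b.repr γ i : ℝ) • F.period (b i) := by
      conv_lhs => rw [← b.sum_repr γ]
      rw [map_sum]
      refine Finset.sum_congr rfl fun i _ => ?_
      rw [map_zsmul, ← Int.cast_smul_eq_zsmul ℝ]
    rw [h]
    exact Submodule.sum_mem _ fun i _ => Submodule.smul_mem _ _ (Submodule.subset_span ⟨i, rfl⟩)
  refine ⟨b, basisOfTopLeSpanOfCardEqFinrank _ hspan (by simp), fun i => ?_⟩
  simp

theorem finite_period_mem {B : Set Plane} (hB : Bornology.IsBounded B) :
    {γ : Γ | F.period γ ∈ B}.Finite := by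
  obtain ⟨b, β, hβ⟩ := F.exists_period_basis
  refine Finite.of_finite_image ((ZSpan.setFinite_inter β hB).subset ?_)
    F.period_injective.injOn
  rintro _ ⟨γ, hγ, rfl⟩
  refine ⟨hγ, ?_⟩
  rw [SetLike.mem_coe, ← b.sum_repr γ, map_sum]
  refine Submodule.sum_mem _ fun i _ => ?_
  rw [map_zsmul, ← hβ]
  exact Submodule.smul_mem _ _ (Submodule.subset_span ⟨i, rfl⟩)

open Pointwise in
theorem finite_edges_meeting {B : Set Plane} (hB : Bornology.IsBounded B) :
    {e : V × V | F.graph.Adj e.1 e.2 ∧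
      (segment ℝ (F.place e.1) (F.place e.2) ∩ B).Nonempty}.Finite := by
  obtain ⟨S, hS⟩ := F.edge_orbits
  have hfin : ∀ s : V × V,
      {γ : Γ | F.period γ ∈ B - segment ℝ (F.place s.1) (F.place s.2)}.Finite := fun s =>
    F.finite_period_mem (hB.sub (isCompact_segment _ _).isBounded)
  refine (S.finite_toSet.biUnion fun s _ => (hfin s).image fun γ => γ +ᵥ s).subset ?_
  rintro ⟨c, d⟩ ⟨hcd, z, hz, hzB⟩
  obtain ⟨γ, s, hs, e⟩ := hS c d hcd
  refine mem_iUnion₂.2 ⟨s, hs, γ, ?_, e⟩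
  have e1 : γ +ᵥ s.1 = c := congrArg Prod.fst e
  have e2 : γ +ᵥ s.2 = d := congrArg Prod.snd e
  simp only at hz
  rw [← e1, ← e2, F.place_vadd, F.place_vadd] at hz
  obtain ⟨α, β, hα, hβ, hab, rfl⟩ := hz
  refine ⟨_, hzB, _, ⟨α, β, hα, hβ, hab, rfl⟩, ?_⟩
  have hα' : α = 1 - β := by linarith
  subst hα'
  ext i; simp; ring

variable {F}

/-- The midpoint of an edge lies on no other edge. -/
theorem NonCrossing.edge_eq_of_midpoint_mem (h : F.NonCrossing) {a b c d : V}
    (hab : F.graph.Adj a b) (hcd : F.graph.Adj c d)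
    (hm : midpoint ℝ (F.place a) (F.place b) ∈ segment ℝ (F.place c) (F.place d)) :
    s(a, b) = s(c, d) := by
  by_contra hne
  obtain ⟨x, ⟨hx, -⟩, e⟩ := h a b c d hab hcd hne ⟨midpoint_mem_segment _ _, hm⟩
  rcases hx with rfl | rfl
  · exact F.place_ne _ _ hab ((midpoint_eq_left_iff ℝ).1 e.symm)
  · exact F.place_ne _ _ hab ((midpoint_eq_right_iff ℝ).1 e.symm)

/-- The face `U` lies to the left of the directed edge from `a` to `b`. -/
def IsLeftFace (F : PeriodicFramework V Γ) (U : Set Plane) (a b : V) : Prop :=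
  F.IsFace U ∧ OnSide U 1 (F.place a) (F.place b)

theorem IsFace.subset {U : Set Plane} (h : F.IsFace U) : U ⊆ F.drawingᶜ := by
  obtain ⟨x, -, rfl⟩ := h
  exact connectedComponentIn_subset _ _

theorem IsFace.eq_of_mem {U U' : Set Plane} (h : F.IsFace U) (h' : F.IsFace U') {z : Plane}
    (hz : z ∈ U) (hz' : z ∈ U') : U = U' := by
  obtain ⟨x, -, rfl⟩ := h
  obtain ⟨x', -, rfl⟩ := h'
  rw [connectedComponentIn_eq hz, connectedComponentIn_eq hz']

theorem IsLeftFace.unique {U U' : Set Plane} {a b : V} (h : F.IsLeftFace U a b)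
    (h' : F.IsLeftFace U' a b) : U = U' := by
  obtain ⟨t, ht, ht'⟩ := (h.2.and h'.2).exists
  exact h.1.eq_of_mem h'.1 ht ht'

/-- Only finitely many edges come near the midpoint of an edge, and none of the others contains it,
so the points close to it on the left avoid the drawing. -/
theorem NonCrossing.exists_isLeftFace (h : F.NonCrossing) {a b : V} (hab : F.graph.Adj a b) :
    ∃ U, F.IsLeftFace U a b := by
  set m := midpoint ℝ (F.place a) (F.place b) with hm
  set e := F.place b - F.place a with he
  have hepos : 0 < inner ℝ e e := real_inner_self_pos.2 (sub_ne_zero.2 (F.place_ne a b hab).symm)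
  set S := {c : V × V | F.graph.Adj c.1 c.2 ∧
      (segment ℝ (F.place c.1) (F.place c.2) ∩ Metric.ball m 1).Nonempty} \ {(a, b), (b, a)} with hS
  have hSfin : S.Finite := (F.finite_edges_meeting Metric.isBounded_ball).sdiff
  have hclosed : IsClosed (⋃ c ∈ S, segment ℝ (F.place c.1) (F.place c.2)) :=
    hSfin.isClosed_biUnion fun c _ => (isCompact_segment _ _).isClosed
  have hmS : m ∉ ⋃ c ∈ S, segment ℝ (F.place c.1) (F.place c.2) := by
    intro hmem
    obtain ⟨c, hc, hmc⟩ := mem_iUnion₂.1 hmem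
    have := h.edge_eq_of_midpoint_mem hab hc.1.1 hmc
    rcases Sym2.eq_iff.1 this with ⟨h1, h2⟩ | ⟨h1, h2⟩
    · exact hc.2 (Or.inl (Prod.ext h1.symm h2.symm))
    · exact hc.2 (Or.inr (Prod.ext h2.symm h1.symm))
  have hev : ∀ᶠ t : ℝ in 𝓝[>] 0, m + t • J e ∈ F.drawingᶜ := by
    filter_upwards [self_mem_nhdsWithin,
      (tendsto_add_smul m (J e)).eventually (Metric.isOpen_ball.mem_nhds
        (Metric.mem_ball_self one_pos)),
      (tendsto_add_smul m (J e)).eventually (hclosed.isOpen_compl.mem_nhds hmS)] with t ht hb hn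
    rw [mem_Ioi] at ht
    have hcross : cross e (m + t • J e - F.place a) ≠ 0 := by
      have : cross e (m + t • J e - F.place a) = t * inner ℝ e e := by
        rw [inner_eq]; simp [cross, hm, he, midpoint_apply]; ring
      rw [this]; positivity
    rintro ⟨c, d, hcd, hz⟩
    have hnS : (c, d) ∉ S := fun hcS => hn (mem_iUnion₂.2 ⟨(c, d), hcS, hz⟩)
    have : (c, d) ∈ ({(a, b), (b, a)} : Set (V × V)) := by
      by_contra hne
      exact hnS ⟨⟨hcd, _, hz, hb⟩, hne⟩
    rcases this with e1 | e1
    · obtain ⟨rfl, rfl⟩ := Prod.mk.inj e1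
      exact hcross (cross_eq_zero_of_mem_segment hz).1
    · obtain ⟨rfl, rfl⟩ := Prod.mk.inj e1
      rw [segment_symm] at hz
      exact hcross (cross_eq_zero_of_mem_segment hz).1
  obtain ⟨ε, hε, hsub⟩ := (nhdsGT_basis (0 : ℝ)).mem_iff.1 hev
  have hpre : IsPreconnected ((fun t : ℝ => m + t • J e) '' Ioo 0 ε) :=
    isPreconnected_Ioo.image _ (by fun_prop)
  have hmid : ε / 2 ∈ Ioo 0 ε := ⟨by linarith, by linarith⟩
  refine ⟨connectedComponentIn F.drawingᶜ (m + (ε / 2) • J e), ⟨_, hsub hmid, rfl⟩, ?_⟩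
  have hin := hpre.subset_connectedComponentIn ⟨_, hmid, rfl⟩ (image_subset_iff.2 hsub)
  filter_upwards [Ioo_mem_nhdsGT hε] with t ht
  rw [one_smul]
  exact hin ⟨t, ht, rfl⟩

theorem add_mem_drawing (γ : Γ) {z : Plane} (hz : z ∈ F.drawing) :
    F.period γ + z ∈ F.drawing := by
  obtain ⟨a, b, hab, hz⟩ := hz
  refine ⟨γ +ᵥ a, γ +ᵥ b, F.adj_vadd γ a b hab, ?_⟩
  rw [F.place_vadd, F.place_vadd]
  exact (mem_segment_translate ℝ _).2 hz

theorem image_drawing_compl (γ : Γ) :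
    Homeomorph.addLeft (F.period γ) '' F.drawingᶜ = F.drawingᶜ := by
  ext z
  constructor
  · rintro ⟨y, hy, rfl⟩ h
    apply hy
    have := add_mem_drawing (-γ) h
    simpa using this
  · intro hz
    refine ⟨-F.period γ + z, fun h => hz ?_, by simp⟩
    have := add_mem_drawing γ h
    simpa using this

theorem IsLeftFace.vadd {U : Set Plane} {a b : V} (h : F.IsLeftFace U a b) (γ : Γ) :
    F.IsLeftFace (Homeomorph.addLeft (F.period γ) '' U) (γ +ᵥ a) (γ +ᵥ b) := by
  obtain ⟨⟨x, hx, rfl⟩, hside⟩ := h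
  refine ⟨⟨F.period γ + x, ?_, ?_⟩, ?_⟩
  · rw [← image_drawing_compl γ]; exact ⟨x, hx, rfl⟩
  · rw [Homeomorph.image_connectedComponentIn _ hx, image_drawing_compl]; rfl
  · filter_upwards [hside] with t ht
    refine ⟨_, ht, ?_⟩
    rw [F.place_vadd, F.place_vadd]
    ext i; simp [midpoint_apply]; ring

/-- Pointedness excludes straight angles between edges, and non-crossing excludes overlapping
edges. -/
theorem IsPseudoTriangulation.cross_ne_zero (hF : F.IsPseudoTriangulation) {a x b : V}
    (ha : F.graph.Adj a x) (hb : F.graph.Adj x b) (hne : F.place a ≠ F.place b)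
    (hseg : segment ℝ (F.place a) (F.place x) ∩ segment ℝ (F.place x) (F.place b) =
      {F.place x}) :
    cross (F.place x - F.place a) (F.place b - F.place x) ≠ 0 := by
  intro h0
  have hxa := sub_ne_zero.2 (F.place_ne a x ha).symm
  have hbx := sub_ne_zero.2 (F.place_ne x b hb).symm
  obtain ⟨c, hc⟩ := exists_smul_of_cross_eq_zero hxa h0
  have hc0 : c ≠ 0 := by rintro rfl; rw [zero_smul] at hc; exact hbx hc
  rcases lt_or_gt_of_ne hc0 with hneg | hpos
  · -- The two edges point in the same direction, so they overlap.
    have hd : 0 < 1 - c := by linarith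
    set z := F.place x + (c / (1 - c)) • (F.place x - F.place a) with hz
    have hz1 : z ∈ segment ℝ (F.place a) (F.place x) := by
      refine ⟨-c / (1 - c), 1 / (1 - c), div_nonneg (by linarith) hd.le, by positivity,
        by field_simp; ring, ?_⟩
      rw [hz]; ext i; simp; field_simp; ring
    have hz2 : z ∈ segment ℝ (F.place x) (F.place b) := by
      refine ⟨-c / (1 - c), 1 / (1 - c), div_nonneg (by linarith) hd.le, by positivity,
        by field_simp; ring, ?_⟩
      have hb' : F.place b = F.place x + c • (F.place x - F.place a) := by rw [← hc]; abel
      rw [hz, hb']; ext i; simp; field_simp; ring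
    have hz3 : z ∈ ({F.place x} : Set Plane) := hseg ▸ ⟨hz1, hz2⟩
    rw [mem_singleton_iff, hz, add_eq_left, smul_eq_zero] at hz3
    rcases hz3 with h | h
    · exact (div_ne_zero hc0 hd.ne') h
    · exact hxa h
  · -- The two edges point in opposite directions, so a positive combination vanishes.
    classical
    have hne' : F.place a - F.place x ≠ F.place b - F.place x := fun e => hne (sub_left_inj.1 e)
    refine hF.2.1 x {F.place a - F.place x, F.place b - F.place x} (by simp) ?_
      (fun z => if z = F.place a - F.place x then c else 1) ?_ ?_
    · intro z hz
      simp only [Finset.coe_insert, Finset.coe_singleton, mem_insert_iff, mem_singleton_iff] at hz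
      rcases hz with rfl | rfl
      · exact ⟨a, ha.symm, rfl⟩
      · exact ⟨b, hb, rfl⟩
    · intro z _; split_ifs <;> linarith
    · rw [Finset.sum_pair hne', if_pos rfl, if_neg hne'.symm, one_smul, hc, ← smul_add]
      simp

theorem IsPseudoTriangulation.exists_oriented_polygon (hF : F.IsPseudoTriangulation)
    {U : Set Plane} (hU : F.IsFace U) :
    ∃ (k : ℕ) (w : ZMod k → V), (∀ i, F.graph.Adj (w i) (w (i + 1))) ∧
      IsOrientedPseudoTriangle (fun i => F.place (w i)) U ∧
      frontier U = ⋃ i, segment ℝ (F.place (w i)) (F.place (w (i + 1))) := by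
  obtain ⟨k, w, hw, hT⟩ := hF.2.2 U hU
  have hc : ∀ i, cross (F.place (w (i + 1)) - F.place (w i))
      (F.place (w (i + 2)) - F.place (w (i + 1))) ≠ 0 := by
    intro i
    have e : i + 2 = i + 1 + 1 := by ring
    refine hF.cross_ne_zero (hw i) (e ▸ hw (i + 1)) (fun h => ?_) (hT.1.2.2.1 i)
    have := hT.1.2.1 h
    exact ZMod.two_ne_zero_of_three_le hT.1.1 (by simpa using this.symm)
  rcases hT.isOriented_or_reverse hc with h | h
  · exact ⟨k, w, hw, h, hT.2.1.2.2.2⟩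
  · refine ⟨k, fun i => w (-i), fun i => ?_, h, hT.reverse.2.1.2.2.2⟩
    have := (hw (-(i + 1))).symm
    rwa [show -(i + 1) + 1 = -i by ring] at this

/-- The directed edges with a given face on their left are the sides of the counterclockwise
boundary polygon of this face. -/
theorem IsPseudoTriangulation.exists_index (hF : F.IsPseudoTriangulation) {U : Set Plane} {k : ℕ}
    {w : ZMod k → V} (hw : ∀ i, F.graph.Adj (w i) (w (i + 1)))
    (hT : IsOrientedPseudoTriangle (fun i => F.place (w i)) U)
    (hfr : frontier U = ⋃ i, segment ℝ (F.place (w i)) (F.place (w (i + 1)))) {a b : V}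
    (hab : F.graph.Adj a b) (h : F.IsLeftFace U a b) : ∃ i, w i = a ∧ w (i + 1) = b := by
  have hm : midpoint ℝ (F.place a) (F.place b) ∈ frontier U := by
    refine ⟨mem_closure_of_tendsto (tendsto_add_smul _ ((1 : ℝ) • J (F.place b - F.place a))) h.2,
      fun hmem => h.1.subset (interior_subset hmem) ⟨a, b, hab, midpoint_mem_segment _ _⟩⟩
  rw [hfr] at hm
  obtain ⟨i, hi⟩ := mem_iUnion.1 hm
  rcases Sym2.eq_iff.1 (hF.1.edge_eq_of_midpoint_mem hab (hw i) hi) with ⟨h1, h2⟩ | ⟨h1, h2⟩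
  · exact ⟨i, h1.symm, h2.symm⟩
  · exfalso
    refine (hT.2.2.1 i).2 ?_
    rw [onSide_neg_swap]
    have := h.2
    rwa [h1, h2] at this

end PeriodicFramework

/-! ### Sums over orbits -/

open Classical in
/-- An injective equivariant map permutes the finitely many orbits. -/
theorem sum_orbits_comp {Γ X : Type*} [AddGroup Γ] [AddAction Γ X]
    [Fintype (AddAction.orbitRel.Quotient Γ X)] {f : X → ℝ} (hf : ∀ (γ : Γ) x, f (γ +ᵥ x) = f x)
    {N : X → X} (hN : ∀ (γ : Γ) x, N (γ +ᵥ x) = γ +ᵥ N x) (hinj : Function.Injective N) :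
    ∑ o : AddAction.orbitRel.Quotient Γ X, f (N (Quotient.out o)) =
      ∑ o : AddAction.orbitRel.Quotient Γ X, f (Quotient.out o) := by
  let fbar : AddAction.orbitRel.Quotient Γ X → ℝ := Quotient.lift f (by
    rintro _ y ⟨γ, rfl⟩; exact hf γ y)
  let Nbar : AddAction.orbitRel.Quotient Γ X → AddAction.orbitRel.Quotient Γ X :=
    Quotient.map N (by rintro _ y ⟨γ, rfl⟩; exact ⟨γ, (hN γ y).symm⟩)
  have hNbar : Function.Injective Nbar := by
    intro a b
    induction a using Quotient.inductionOn with | h x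
    induction b using Quotient.inductionOn with | h y
    intro e
    obtain ⟨γ, hγ⟩ := Quotient.exact e
    refine Quotient.sound ⟨γ, hinj ?_⟩
    rw [← hγ]; exact hN γ y
  have h1 : ∀ o, f (Quotient.out o) = fbar o := fun o => by
    conv_rhs => rw [← Quotient.out_eq o]
    rfl
  have h2 : ∀ o, f (N (Quotient.out o)) = fbar (Nbar o) := fun o => by
    conv_rhs => rw [← Quotient.out_eq o]
    rfl
  simp only [h1, h2]
  exact (Finite.injective_iff_bijective.1 hNbar).sum_comp fbar

namespace PeriodicFramework

variable {V Γ : Type*} [AddCommGroup Γ] [AddAction Γ V] {F : PeriodicFramework V Γ}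

/-! ### Walking around the faces -/

/-- The action of the periodicity group on the directed edges. -/
instance dartAction (F : PeriodicFramework V Γ) : AddAction Γ F.graph.Dart where
  vadd γ d := ⟨(γ +ᵥ d.fst, γ +ᵥ d.snd), F.adj_vadd γ _ _ d.adj⟩
  zero_vadd d := by
    apply SimpleGraph.Dart.ext
    exact Prod.ext (zero_vadd Γ d.fst) (zero_vadd Γ d.snd)
  add_vadd γ δ d := by
    apply SimpleGraph.Dart.ext
    exact Prod.ext (add_vadd γ δ d.fst) (add_vadd γ δ d.snd)

@[simp] theorem dart_vadd_fst (γ : Γ) (d : F.graph.Dart) : (γ +ᵥ d).fst = γ +ᵥ d.fst := rfl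

@[simp] theorem dart_vadd_snd (γ : Γ) (d : F.graph.Dart) : (γ +ᵥ d).snd = γ +ᵥ d.snd := rfl

theorem dart_ext {d d' : F.graph.Dart} (h1 : d.fst = d'.fst) (h2 : d.snd = d'.snd) : d = d' :=
  SimpleGraph.Dart.ext _ _ (Prod.ext h1 h2)

theorem finite_dart_orbits (F : PeriodicFramework V Γ) :
    Finite (AddAction.orbitRel.Quotient Γ F.graph.Dart) := by
  classical
  obtain ⟨S, hS⟩ := F.edge_orbits
  let T : Set F.graph.Dart := {d | (d.fst, d.snd) ∈ S}
  have hT : T.Finite := Finite.of_finite_image (f := fun d : F.graph.Dart => (d.fst, d.snd))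
    (S.finite_toSet.subset (by rintro _ ⟨d, hd, rfl⟩; exact hd))
    (fun d _ d' _ e => dart_ext (Prod.mk.inj e).1 (Prod.mk.inj e).2)
  have := hT.to_subtype
  refine Finite.of_surjective
    (fun d : T => (Quotient.mk _ d.1 : AddAction.orbitRel.Quotient Γ F.graph.Dart)) fun o => ?_
  induction o using Quotient.inductionOn with | h d
  obtain ⟨γ, s, hs, e⟩ := hS d.fst d.snd d.adj
  have e1 : γ +ᵥ s.1 = d.fst := congrArg Prod.fst e
  have e2 : γ +ᵥ s.2 = d.snd := congrArg Prod.snd e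
  have hadj : F.graph.Adj s.1 s.2 := by
    have := F.adj_vadd (-γ) _ _ d.adj
    rwa [← e1, ← e2, neg_vadd_vadd, neg_vadd_vadd] at this
  refine ⟨⟨⟨s, hadj⟩, hs⟩, Quotient.sound ⟨-γ, ?_⟩⟩
  apply dart_ext
  · change -γ +ᵥ d.fst = s.1
    rw [← e1, neg_vadd_vadd]
  · change -γ +ᵥ d.snd = s.2
    rw [← e2, neg_vadd_vadd]

/-- The directed edge `d'` follows `d` on the counterclockwise boundary of their common left
face. -/
def IsNext (d d' : F.graph.Dart) : Prop :=
  d'.fst = d.snd ∧ ∃ U, F.IsLeftFace U d.fst d.snd ∧ F.IsLeftFace U d'.fst d'.snd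

theorem IsNext.vadd {d d' : F.graph.Dart} (h : IsNext d d') (γ : Γ) :
    IsNext (γ +ᵥ d) (γ +ᵥ d') := by
  obtain ⟨h1, U, hU, hU'⟩ := h
  exact ⟨by rw [dart_vadd_fst, dart_vadd_snd, h1], _, hU.vadd γ, hU'.vadd γ⟩

namespace IsPseudoTriangulation

/-- The left face of a directed edge, with its boundary polygon enumerated counterclockwise from
this edge. -/
theorem exists_polygon (hF : F.IsPseudoTriangulation) (d : F.graph.Dart) :
    ∃ (U : Set Plane) (k : ℕ) (w : ZMod k → V) (hw : ∀ i, F.graph.Adj (w i) (w (i + 1)))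
      (i₀ : ZMod k), IsOrientedPseudoTriangle (fun i => F.place (w i)) U ∧
      (∀ i, F.IsLeftFace U (w i) (w (i + 1))) ∧
      (∀ d' : F.graph.Dart, F.IsLeftFace U d'.fst d'.snd → ∃ i, d' = ⟨(w i, w (i + 1)), hw i⟩) ∧
      d = ⟨(w i₀, w (i₀ + 1)), hw i₀⟩ := by
  obtain ⟨U, hU⟩ := hF.1.exists_isLeftFace d.adj
  obtain ⟨k, w, hw, hT, hfr⟩ := hF.exists_oriented_polygon hU.1
  have hall : ∀ d' : F.graph.Dart, F.IsLeftFace U d'.fst d'.snd →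
      ∃ i, d' = ⟨(w i, w (i + 1)), hw i⟩ := fun d' hd' => by
    obtain ⟨i, h1, h2⟩ := hF.exists_index hw hT hfr d'.adj hd'
    exact ⟨i, dart_ext h1.symm h2.symm⟩
  obtain ⟨i₀, hi₀⟩ := hall d hU
  exact ⟨U, k, w, hw, i₀, hT, fun i => ⟨hU.1, (hT.2.2.1 i).1⟩, hall, hi₀⟩

theorem exists_isNext (hF : F.IsPseudoTriangulation) (d : F.graph.Dart) : ∃ d', IsNext d d' := by
  obtain ⟨U, k, w, hw, i, -, hl, -, rfl⟩ := hF.exists_polygon d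
  exact ⟨⟨(w (i + 1), w (i + 1 + 1)), hw (i + 1)⟩, rfl, U, hl i, hl (i + 1)⟩

theorem isNext_right_unique (hF : F.IsPseudoTriangulation) {d d₁ d₂ : F.graph.Dart}
    (h₁ : IsNext d d₁) (h₂ : IsNext d d₂) : d₁ = d₂ := by
  obtain ⟨U, k, w, hw, i, hT, hl, hall, rfl⟩ := hF.exists_polygon d
  obtain ⟨e₁, U₁, hU₁, hU₁'⟩ := h₁
  obtain ⟨e₂, U₂, hU₂, hU₂'⟩ := h₂
  obtain rfl := (hl i).unique hU₁
  obtain rfl := (hl i).unique hU₂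
  obtain ⟨i₁, rfl⟩ := hall d₁ hU₁'
  obtain ⟨i₂, rfl⟩ := hall d₂ hU₂'
  have : i₁ = i₂ := hT.2.1 (congrArg F.place (e₁.trans e₂.symm))
  subst this; rfl

theorem isNext_left_unique (hF : F.IsPseudoTriangulation) {d d₁ d₂ : F.graph.Dart}
    (h₁ : IsNext d₁ d) (h₂ : IsNext d₂ d) : d₁ = d₂ := by
  obtain ⟨U, k, w, hw, i, hT, hl, hall, rfl⟩ := hF.exists_polygon d
  obtain ⟨e₁, U₁, hU₁', hU₁⟩ := h₁
  obtain ⟨e₂, U₂, hU₂', hU₂⟩ := h₂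
  obtain rfl := (hl i).unique hU₁
  obtain rfl := (hl i).unique hU₂
  obtain ⟨i₁, rfl⟩ := hall d₁ hU₁'
  obtain ⟨i₂, rfl⟩ := hall d₂ hU₂'
  have : i₁ + 1 = i₂ + 1 := hT.2.1 (congrArg F.place (e₁.symm.trans e₂))
  obtain rfl := add_right_cancel this
  rfl

theorem iterate_next (hF : F.IsPseudoTriangulation) {N : F.graph.Dart → F.graph.Dart}
    (hN : ∀ d, IsNext d (N d)) {U : Set Plane} {k : ℕ} {w : ZMod k → V}
    (hw : ∀ i, F.graph.Adj (w i) (w (i + 1))) (hl : ∀ i, F.IsLeftFace U (w i) (w (i + 1)))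
    (i : ZMod k) (n : ℕ) :
    N^[n] ⟨(w i, w (i + 1)), hw i⟩ = ⟨(w (i + n), w (i + n + 1)), hw (i + n)⟩ := by
  induction n with
  | zero => simp
  | succ n ih =>
    rw [Function.iterate_succ_apply', ih]
    have h2 : IsNext (F := F) ⟨(w (i + n), w (i + n + 1)), hw (i + n)⟩
        ⟨(w (i + n + 1), w (i + n + 1 + 1)), hw (i + n + 1)⟩ := ⟨rfl, U, hl _, hl _⟩
    rw [hF.isNext_right_unique (hN _) h2]
    apply dart_ext <;> simp [add_assoc]

/-- The walks around all faces close up after a common number of steps. -/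
theorem exists_common_period (hF : F.IsPseudoTriangulation) {N : F.graph.Dart → F.graph.Dart}
    (hN : ∀ d, IsNext d (N d)) (hNv : ∀ (γ : Γ) d, N (γ +ᵥ d) = γ +ᵥ N d) :
    ∃ K : ℕ, 0 < K ∧ ∀ d, N^[K] d = d := by
  have := F.finite_dart_orbits
  have := Fintype.ofFinite (AddAction.orbitRel.Quotient Γ F.graph.Dart)
  have hper : ∀ d, ∃ k, 0 < k ∧ Function.IsPeriodicPt N k d := fun d => by
    obtain ⟨U, k, w, hw, i, hT, hl, -, rfl⟩ := hF.exists_polygon d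
    refine ⟨k, by have := hT.1; omega, ?_⟩
    rw [Function.IsPeriodicPt, Function.IsFixedPt, hF.iterate_next hN hw hl]
    apply dart_ext <;> simp
  choose κ hκ0 hκ using hper
  refine ⟨∏ o : AddAction.orbitRel.Quotient Γ F.graph.Dart, κ (Quotient.out o),
    Finset.prod_pos fun o _ => hκ0 _, fun d => ?_⟩
  obtain ⟨γ, hγ⟩ : d ∈ AddAction.orbit Γ (Quotient.out
      (Quotient.mk _ d : AddAction.orbitRel.Quotient Γ F.graph.Dart)) := by
    have := Quotient.out_eq (Quotient.mk _ d : AddAction.orbitRel.Quotient Γ F.graph.Dart)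
    exact Quotient.exact this.symm
  set o := (Quotient.mk _ d : AddAction.orbitRel.Quotient Γ F.graph.Dart)
  have h1 : Function.IsPeriodicPt N (∏ o : AddAction.orbitRel.Quotient Γ F.graph.Dart,
      κ (Quotient.out o)) (Quotient.out o) :=
    (hκ _).trans_dvd (Finset.dvd_prod_of_mem _ (Finset.mem_univ o))
  have hit : ∀ n d, N^[n] (γ +ᵥ d) = γ +ᵥ N^[n] d := fun n => by
    induction n with
    | zero => intro _; rfl
    | succ n ih => intro d; rw [Function.iterate_succ_apply, hNv, ih, Function.iterate_succ_apply]
  change γ +ᵥ Quotient.out o = d at hγ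
  rw [← hγ, hit, h1.eq]

/-- Positive definiteness of the area form of the face to the left of a directed edge, evaluated on
a walk that runs around the face several times. -/
theorem area_walk (hF : F.IsPseudoTriangulation) {N : F.graph.Dart → F.graph.Dart}
    (hN : ∀ d, IsNext d (N d)) {K : ℕ} (hK : 0 < K) {d : F.graph.Dart} (hd : N^[K] d = d)
    {r : V → Plane} (hr : ∀ a b, F.graph.Adj a b →
      cross (F.place b - F.place a) (r b - r a) = 0) :
    0 ≤ ∑ n ∈ Finset.range K, cross (r (N^[n] d).fst) (r (N^[n] d).snd) ∧
      (∑ n ∈ Finset.range K, cross (r (N^[n] d).fst) (r (N^[n] d).snd) = 0 →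
        r d.fst = r d.snd) := by
  obtain ⟨U, k, w, hw, i, hT, hl, -, rfl⟩ := hF.exists_polygon d
  have hlam : ∀ j, ∃ c : ℝ, r (w (j + 1)) - r (w j) = c • (F.place (w (j + 1)) - F.place (w j)) :=
    fun j => exists_smul_of_cross_eq_zero (sub_ne_zero.2 (F.place_ne _ _ (hw j)).symm)
      (hr _ _ (hw j))
  choose l hlam using hlam
  obtain ⟨h0, h1⟩ := hT.2.2.2 (fun j => r (w j)) l (fun j => by rw [← hlam]; abel) i
  have hkK : k ∣ K := by
    rw [hF.iterate_next hN hw hl] at hd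
    have : w (i + K) = w i := congrArg (fun d : F.graph.Dart => d.fst) hd
    have := hT.2.1 (congrArg F.place this)
    rw [← ZMod.natCast_eq_zero_iff]
    simpa using this
  obtain ⟨t, rfl⟩ := hkK
  simp only [hF.iterate_next hN hw hl]
  have hsum : ∀ t : ℕ, ∑ n ∈ Finset.range (k * t), cross (r (w (i + n))) (r (w (i + n + 1))) =
      t * ∑ n ∈ Finset.range k, cross (r (w (i + n))) (r (w (i + n + 1))) := by
    intro t
    induction t with
    | zero => simp
    | succ t ih =>
      rw [Nat.mul_succ, Finset.sum_range_add, ih]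
      simp; ring
  have ht : (0 : ℝ) < t := by exact_mod_cast Nat.pos_of_mul_pos_left hK
  rw [hsum]
  refine ⟨mul_nonneg ht.le h0, fun h => ?_⟩
  have h2 := h1 ((mul_eq_zero.1 h).resolve_left ht.ne') i
  have h3 := hlam i
  rw [h2, zero_smul, sub_eq_zero] at h3
  exact h3.symm

end IsPseudoTriangulation

/-! ### The area identity -/

theorem det_eq_cross (L : Plane →ₗ[ℝ] Plane) :
    LinearMap.det L = cross (L !₂[1, 0]) (L !₂[0, 1]) := by
  have h0 : EuclideanSpace.single (0 : Fin 2) (1 : ℝ) = !₂[1, 0] := ext_coords (by simp) (by simp)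
  have h1 : EuclideanSpace.single (1 : Fin 2) (1 : ℝ) = !₂[0, 1] := ext_coords (by simp) (by simp)
  rw [← LinearMap.det_toMatrix (EuclideanSpace.basisFun (Fin 2) ℝ).toBasis, Matrix.det_fin_two]
  simp [LinearMap.toMatrix_apply, h0, h1, cross]
  ring

theorem apply_eq_coords (L : Plane →ₗ[ℝ] Plane) (x : Plane) :
    L x = x 0 • L !₂[1, 0] + x 1 • L !₂[0, 1] := by
  rw [← map_smul, ← map_smul, ← map_add]
  congr 1
  exact ext_coords (by simp) (by simp)

theorem cross_map (L : Plane →ₗ[ℝ] Plane) (x y : Plane) :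
    cross (L x) (L y) = LinearMap.det L * cross x y := by
  rw [apply_eq_coords L x, apply_eq_coords L y, det_eq_cross]
  simp [cross]; ring

/-- The periods of an equivariant placement are the image of the lattice under a linear map. -/
theorem exists_linearMap_period (F : PeriodicFramework V Γ) (ρ : Γ →+ Plane) :
    ∃ L : Plane →ₗ[ℝ] Plane, ∀ γ, ρ γ = L (F.period γ) := by
  obtain ⟨b, B, hB⟩ := F.exists_period_basis
  refine ⟨B.constr ℝ fun i => ρ (b i), fun γ => ?_⟩
  have h : ρ.toIntLinearMap =
      ((B.constr ℝ fun i => ρ (b i)).toAddMonoidHom.comp F.period).toIntLinearMap := by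
    refine b.ext fun i => ?_
    change ρ (b i) = (B.constr ℝ fun i => ρ (b i)) (F.period (b i))
    rw [← hB, Module.Basis.constr_basis]
  exact LinearMap.congr_fun h γ

open Classical in
/-- Discrete Green identity: summed over the orbits of directed edges, the areas enclosed by the
walks around the faces are multiplied by `det L` when the placement is replaced by an equivariant
map `r` with periods `L ∘ π`. Indeed `r = L ∘ p + h` with `h` invariant, and up to telescoping terms
the part involving `h` is the sum of an invariant function which changes sign under the reversal of
directed edges. -/
theorem sum_area_eq_det_mul [Fintype (AddAction.orbitRel.Quotient Γ F.graph.Dart)]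
    {N : F.graph.Dart → F.graph.Dart} (hNfst : ∀ d, (N d).fst = d.snd)
    (hNv : ∀ (γ : Γ) d, N (γ +ᵥ d) = γ +ᵥ N d) (hNinj : Function.Injective N) {K : ℕ}
    (hK : ∀ d, N^[K] d = d) {r : V → Plane} {ρ : Γ →+ Plane}
    (hr : ∀ (γ : Γ) a, r (γ +ᵥ a) = ρ γ + r a) {L : Plane →ₗ[ℝ] Plane}
    (hL : ∀ γ, ρ γ = L (F.period γ)) :
    ∑ o : AddAction.orbitRel.Quotient Γ F.graph.Dart, ∑ n ∈ Finset.range K,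
        cross (r (N^[n] (Quotient.out o)).fst) (r (N^[n] (Quotient.out o)).snd) =
      LinearMap.det L * ∑ o : AddAction.orbitRel.Quotient Γ F.graph.Dart, ∑ n ∈ Finset.range K,
        cross (F.place (N^[n] (Quotient.out o)).fst) (F.place (N^[n] (Quotient.out o)).snd) := by
  set P : V → Plane := fun a => L (F.place a) with hP
  set h : V → Plane := fun a => r a - P a with hh
  have hPv : ∀ (γ : Γ) a, P (γ +ᵥ a) = L (F.period γ) + P a := fun γ a => by
    simp [hP, F.place_vadd]
  have hinv : ∀ (γ : Γ) a, h (γ +ᵥ a) = h a := fun γ a => by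
    simp only [hh, hr, hPv, hL]; abel
  set G : F.graph.Dart → ℝ := fun d =>
    cross (h d.fst + h d.snd) (P d.snd - P d.fst) + cross (h d.fst) (h d.snd) with hG
  set Φ : V → ℝ := fun a => cross (h a) (P a) with hΦ
  have hGinv : ∀ (γ : Γ) d, G (γ +ᵥ d) = G d := fun γ d => by
    simp only [hG, dart_vadd_fst, dart_vadd_snd, hinv, hPv, add_sub_add_left_eq_sub]
  have hGsymm : ∀ d : F.graph.Dart, G d.symm = -G d := fun d => by
    change cross (h d.snd + h d.fst) (P d.fst - P d.snd) + cross (h d.snd) (h d.fst) = -G d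
    simp only [hG, cross]; simp; ring
  have hGzero : ∑ o : AddAction.orbitRel.Quotient Γ F.graph.Dart, G (Quotient.out o) = 0 := by
    have h1 := sum_orbits_comp (Γ := Γ) hGinv (N := fun d : F.graph.Dart => d.symm)
      (fun γ d => rfl) (fun d d' e => by simpa using congrArg SimpleGraph.Dart.symm e)
    simp only [hGsymm, Finset.sum_neg_distrib] at h1
    linarith
  have hNit : ∀ n, ∑ o : AddAction.orbitRel.Quotient Γ F.graph.Dart,
      G (N^[n] (Quotient.out o)) = 0 := fun n => by
    rw [← hGzero]
    refine sum_orbits_comp hGinv (fun γ d => ?_) (hNinj.iterate n)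
    induction n with
    | zero => rfl
    | succ n ih => rw [Function.iterate_succ_apply', ih, hNv, Function.iterate_succ_apply']
  have hterm : ∀ d : F.graph.Dart, cross (r d.fst) (r d.snd) =
      LinearMap.det L * cross (F.place d.fst) (F.place d.snd) + G d - (Φ d.snd - Φ d.fst) := by
    intro d
    rw [← cross_map]
    have e : ∀ a, r a = P a + h a := fun a => by simp only [hh]; abel
    rw [e d.fst, e d.snd]
    simp only [hG, hΦ, cross]; simp [hP]; ring
  have hwalk : ∀ d : F.graph.Dart, ∑ n ∈ Finset.range K,
      cross (r (N^[n] d).fst) (r (N^[n] d).snd) =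
      LinearMap.det L *
          (∑ n ∈ Finset.range K, cross (F.place (N^[n] d).fst) (F.place (N^[n] d).snd)) +
        ∑ n ∈ Finset.range K, G (N^[n] d) := fun d => by
    simp only [hterm]
    rw [Finset.sum_sub_distrib, Finset.sum_add_distrib, ← Finset.mul_sum]
    have htel : ∑ n ∈ Finset.range K, (Φ (N^[n] d).snd - Φ (N^[n] d).fst) = 0 := by
      have h1 := Finset.sum_range_sub (fun n => Φ (N^[n] d).fst) K
      rw [hK d, Function.iterate_zero, id_eq, sub_self] at h1
      rw [← h1]
      refine Finset.sum_congr rfl fun n _ => ?_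
      rw [Function.iterate_succ_apply', hNfst]
    rw [htel, sub_zero]
  simp only [hwalk]
  rw [Finset.sum_add_distrib, ← Finset.mul_sum, Finset.sum_comm (f := fun _ n => G _)]
  simp only [hNit, Finset.sum_const_zero, add_zero]

/-- A periodic parallel redrawing of a pseudo-triangulation whose lattice is not of positive
orientation is a single point. -/
theorem IsPseudoTriangulation.redrawing_eq (hF : F.IsPseudoTriangulation) {r : V → Plane}
    {ρ : Γ →+ Plane} (hr : ∀ (γ : Γ) a, r (γ +ᵥ a) = ρ γ + r a)
    (hpar : ∀ a b, F.graph.Adj a b → cross (F.place b - F.place a) (r b - r a) = 0)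
    {L : Plane →ₗ[ℝ] Plane} (hL : ∀ γ, ρ γ = L (F.period γ)) (hdet : LinearMap.det L ≤ 0)
    (a b : V) : r a = r b := by
  have := F.finite_dart_orbits
  have := Fintype.ofFinite (AddAction.orbitRel.Quotient Γ F.graph.Dart)
  choose N hN using hF.exists_isNext
  have hNv : ∀ (γ : Γ) d, N (γ +ᵥ d) = γ +ᵥ N d := fun γ d =>
    hF.isNext_right_unique (hN _) ((hN d).vadd γ)
  have hNinj : Function.Injective N := fun d d' e =>
    hF.isNext_left_unique (hN d) (e ▸ hN d')
  obtain ⟨K, hK0, hK⟩ := hF.exists_common_period hN hNv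
  have hsum := sum_area_eq_det_mul (fun d => (hN d).1) hNv hNinj hK hr hL
  have hp : ∀ d : F.graph.Dart, 0 ≤ ∑ n ∈ Finset.range K,
      cross (F.place (N^[n] d).fst) (F.place (N^[n] d).snd) := fun d =>
    (hF.area_walk hN hK0 (hK d) (r := F.place) (fun _ _ _ => cross_self _)).1
  have hrnn : ∀ d : F.graph.Dart, 0 ≤ ∑ n ∈ Finset.range K,
      cross (r (N^[n] d).fst) (r (N^[n] d).snd) := fun d =>
    (hF.area_walk hN hK0 (hK d) hpar).1
  have hzero := (Finset.sum_eq_zero_iff_of_nonneg fun o _ => hrnn _).1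
    (le_antisymm (hsum.le.trans (mul_nonpos_of_nonpos_of_nonneg hdet
      (Finset.sum_nonneg fun o _ => hp _))) (Finset.sum_nonneg fun o _ => hrnn _))
  have hedge : ∀ d : F.graph.Dart, r d.fst = r d.snd := by
    intro d
    have hmk := Quotient.out_eq (Quotient.mk _ d : AddAction.orbitRel.Quotient Γ F.graph.Dart)
    obtain ⟨γ, hγ⟩ := Quotient.exact hmk.symm
    change γ +ᵥ Quotient.out
      (Quotient.mk _ d : AddAction.orbitRel.Quotient Γ F.graph.Dart) = d at hγ
    have h1 := (hF.area_walk hN hK0 (hK _) hpar).2 (hzero (Quotient.mk _ d) (Finset.mem_univ _))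
    rw [← hγ, dart_vadd_fst, dart_vadd_snd, hr, hr, h1]
  obtain ⟨p⟩ := F.connected.preconnected a b
  induction p with
  | nil => rfl
  | cons hadj _ ih => exact (show r _ = r _ from hedge ⟨(_, _), hadj⟩).trans ih

/-! ### Infinitesimal motions -/

/-- The space of infinitesimal motions of a periodic pseudo-triangulation is at most one-dimensional
modulo trivial motions. Rotating velocities by a right angle turns motions into parallel redrawings.
Among the combinations of two redrawings and the placement itself, a nonzero one has a symmetric
traceless lattice matrix, which has nonpositive determinant. -/
theorem IsPseudoTriangulation.exists_combination_trivial (hF : F.IsPseudoTriangulation)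
    {vel₁ vel₂ : V → Plane} {per₁ per₂ : Γ →+ Plane} (h₁ : F.IsInfinitesimalMotion vel₁ per₁)
    (h₂ : F.IsInfinitesimalMotion vel₂ per₂) :
    ∃ (x y z : ℝ) (t : Plane), (x ≠ 0 ∨ y ≠ 0) ∧
      (∀ a, x • vel₁ a + y • vel₂ a = z • J (F.place a) + t) ∧
      ∀ γ, x • per₁ γ + y • per₂ γ = z • J (F.period γ) := by
  obtain ⟨L₁, hL₁⟩ := exists_linearMap_period F (J.toAddMonoidHom.comp per₁)
  obtain ⟨L₂, hL₂⟩ := exists_linearMap_period F (J.toAddMonoidHom.comp per₂)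
  -- The skew part of the lattice matrix is removed by the choice of `x` and `y`, the trace by that
  -- of `z`.
  set α₁ := L₁ !₂[1, 0] 1 - L₁ !₂[0, 1] 0 with hα₁
  set α₂ := L₂ !₂[1, 0] 1 - L₂ !₂[0, 1] 0 with hα₂
  obtain ⟨x, y, hxy, hskew⟩ : ∃ x y : ℝ, (x ≠ 0 ∨ y ≠ 0) ∧ x * α₁ + y * α₂ = 0 := by
    by_cases h : α₁ = 0
    · exact ⟨1, 0, Or.inl one_ne_zero, by simp [h]⟩
    · exact ⟨α₂, -α₁, Or.inr (neg_ne_zero.2 h), by ring⟩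
  obtain ⟨z, htr⟩ : ∃ z : ℝ, x * (L₁ !₂[1, 0] 0 + L₁ !₂[0, 1] 1) +
      y * (L₂ !₂[1, 0] 0 + L₂ !₂[0, 1] 1) + 2 * z = 0 :=
    ⟨-(x * (L₁ !₂[1, 0] 0 + L₁ !₂[0, 1] 1) + y * (L₂ !₂[1, 0] 0 + L₂ !₂[0, 1] 1)) / 2, by ring⟩
  set r : V → Plane := fun a => J (x • vel₁ a + y • vel₂ a) + z • F.place a with hr
  set L : Plane →ₗ[ℝ] Plane := x • L₁ + y • L₂ + z • LinearMap.id with hLdef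
  have hdet : LinearMap.det L ≤ 0 := by
    have e : LinearMap.det L = -(L !₂[1, 0] 0) ^ 2 - (L !₂[1, 0] 1) ^ 2 := by
      have e1 : L !₂[0, 1] 1 = -(L !₂[1, 0] 0) := by
        simp [hLdef]; linarith
      have e2 : L !₂[0, 1] 0 = L !₂[1, 0] 1 := by
        simp [hLdef]; rw [hα₁, hα₂] at hskew; linarith
      rw [det_eq_cross, cross, e1, e2]; ring
    rw [e]
    nlinarith [sq_nonneg (L !₂[1, 0] 0), sq_nonneg (L !₂[1, 0] 1)]
  have hconst := hF.redrawing_eq (r := r) (ρ := L.toAddMonoidHom.comp F.period) (L := L)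
    (fun γ a => by
      have e1 : J (per₁ γ) = L₁ (F.period γ) := hL₁ γ
      have e2 : J (per₂ γ) = L₂ (F.period γ) := hL₂ γ
      change r (γ +ᵥ a) = (x • L₁ (F.period γ) + y • L₂ (F.period γ) + z • F.period γ) + r a
      simp only [hr, h₁.1, h₂.1, F.place_vadd, map_add, map_smul, smul_add, e1, e2]
      abel)
    (fun a b hab => by
      have e1 := h₁.2 a b hab
      have e2 := h₂.2 a b hab
      have e : r b - r a = x • J (vel₁ b - vel₁ a) + y • J (vel₂ b - vel₂ a) +
          z • (F.place b - F.place a) := by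
        simp only [hr, map_add, map_smul, map_sub, smul_sub]; abel
      rw [e, cross_add_right, cross_add_right, cross_smul_right, cross_smul_right,
        cross_smul_right, cross_J_right, cross_J_right, e1, e2, cross_self]
      ring)
    (fun γ => rfl) hdet
  obtain ⟨a₀⟩ := F.connected.nonempty
  have hvel : ∀ a, x • vel₁ a + y • vel₂ a = z • J (F.place a) + -J (r a₀) := fun a => by
    have h3 := congrArg J (hconst a a₀)
    simp only [hr] at h3
    rw [map_add, J_J, map_smul] at h3
    simp only [hr]
    rw [← h3]; abel
  refine ⟨x, y, z, -J (r a₀), hxy, hvel, fun γ => ?_⟩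
  have h3 := hvel (γ +ᵥ a₀)
  rw [h₁.1, h₂.1, F.place_vadd, map_add, smul_add, smul_add, smul_add] at h3
  have h4 := hvel a₀
  have h5 : x • per₁ γ + y • per₂ γ + (x • vel₁ a₀ + y • vel₂ a₀) =
      z • J (F.period γ) + (x • vel₁ a₀ + y • vel₂ a₀) := by
    rw [add_add_add_comm, h3, h4, add_assoc]
  exact add_right_cancel h5

/-- A motion of a periodic pseudo-triangulation that preserves a distance varied by some other
motion is trivial. -/
theorem IsPseudoTriangulation.isTrivialMotion_of_inner_eq_zero (hF : F.IsPseudoTriangulation)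
    {vel vel' : V → Plane} {per per' : Γ →+ Plane} (h : F.IsInfinitesimalMotion vel per)
    {u v : V} (hvar : F.distanceVariation vel u v ≠ 0) (h' : F.IsInfinitesimalMotion vel' per')
    (huv : F.distanceVariation vel' u v = 0) : F.IsTrivialMotion vel' per' := by
  obtain ⟨x, y, z, t, hxy, hvel, hper⟩ := hF.exists_combination_trivial h h'
  have hx : x = 0 := by
    have e : x * F.distanceVariation vel u v + y * F.distanceVariation vel' u v = 0 := by
      unfold distanceVariation
      rw [← real_inner_smul_right, ← real_inner_smul_right, ← inner_add_right]
      have : x • (vel v - vel u) + y • (vel' v - vel' u) = z • J (F.place v - F.place u) := by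
        rw [smul_sub, smul_sub, map_sub, smul_sub, sub_add_sub_comm, hvel, hvel]; abel
      rw [this, real_inner_smul_right, ← cross_J_right, J_J, cross_neg_right, cross_self]
      simp
    rw [huv, mul_zero, add_zero] at e
    exact (mul_eq_zero.1 e).resolve_right hvar
  have hy : y ≠ 0 := hxy.resolve_left fun h => h hx
  subst hx
  simp only [zero_smul, zero_add] at hvel hper
  refine ⟨(y⁻¹ * z) • J, y⁻¹ • t, fun a b => ?_, fun a => ?_, fun γ => ?_⟩
  · rw [LinearMap.smul_apply, LinearMap.smul_apply, real_inner_smul_left, real_inner_smul_right,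
      inner_J]
    ring
  · rw [LinearMap.smul_apply, mul_smul, ← smul_add, ← hvel, inv_smul_smul₀ hy]
  · rw [LinearMap.smul_apply, mul_smul, ← hper, inv_smul_smul₀ hy]

theorem adj_insertEdgeOrbit (F : PeriodicFramework V Γ) {u v : V} (huv : F.place u ≠ F.place v) :
    (F.insertEdgeOrbit u v huv).graph.Adj u v :=
  Or.inr ⟨fun e => huv (congrArg F.place e), Or.inl ⟨0, (zero_vadd Γ u).symm, (zero_vadd Γ v).symm⟩⟩

end PeriodicFramework

theorem mainTheorem5 {V Γ : Type*} [AddCommGroup Γ] [AddAction Γ V]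
    (F : PeriodicFramework V Γ) (hF : F.IsPseudoTriangulation)
    (vel : V → Plane) (per : Γ →+ Plane) (hmotion : F.IsInfinitesimalMotion vel per)
    (u v : V) (hvar : F.distanceVariation vel u v ≠ 0) :
    (F.insertEdgeOrbit u v (F.place_ne_of_distanceVariation_ne_zero hvar)).Ultrarigid := by
  have hadj := F.adj_insertEdgeOrbit (F.place_ne_of_distanceVariation_ne_zero hvar)
  refine ⟨fun vel' per' h' => ?_, fun H _ vel' per' h' => ?_⟩
  · exact hF.isTrivialMotion_of_inner_eq_zero hmotion hvar
      ⟨h'.1, fun a b hab => h'.2 a b (Or.inl hab)⟩ (h'.2 u v hadj)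
  · -- The given motion is also a motion of the relaxed framework, which is again a
    -- pseudo-triangulation.
    have hF' : (F.relax H).IsPseudoTriangulation := hF
    exact hF'.isTrivialMotion_of_inner_eq_zero (vel := vel) (per := per.comp H.subtype)
      ⟨fun γ a => hmotion.1 γ a, hmotion.2⟩ hvar
      ⟨h'.1, fun a b hab => h'.2 a b (Or.inl hab)⟩ (h'.2 u v hadj)
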